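/- **Online resource allocation.** Let $\mathcal J$ and $\mathcal K$ be finite sets of supply nodes and resources, $d=|\mathcal K|$, let $b\in\mathbb R^{\mathcal K}$ be the capacities, and let $T$ be the number of periods. Items $\xi^t=(r^t,A^t)$, $t=1,\dots,T$, with rewards $r^t\in\mathbb R^{\mathcal J}$ and non-negative resource consumptions $A^t\in\mathbb R_{\ge 0}^{\mathcal J\times\mathcal K}$, arrive one at a time and are i.i.d. with an arbitrary law $\mathcal D$. Each item is irrevocably assigned to at most one supply node: its action is some $x^t\in\Delta=\{x\in\{0,1\}^{\mathcal J}:\sum_j x_j\le 1\}$. For items $\xi^1,\dots,\xi^n$ and capacities $b'\in\mathbb R^{\mathcal K}$, the offline problem is $$\max\Big\{\sum_{t=1}^n r^t\cdot x^t \;:\; x^1,\dots,x^n\in\Delta,\ \sum_{t=1}^n (A^t)^\top x^t\le b'\Big\}.$$ Let $\mathrm{OPT}$ be its optimal value for $n=T$, $b'=b$, and assume that $\mathbb E[\mathrm{OPT}]$ exists and is finite. **Solver.** A solver returns an optimal solution of every feasible instance of the offline problem (any $n$, any capacities); it may use a random seed (e.g. to break ties) and depends measurably on the seed and the data. It is *equivariant*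 if permuting the items permutes the returned solution in the same way: for every feasible instance and every permutation $\pi$ of $\{1,\dots,n\}$, if $(x^1,\dots,x^n)$ is the solution returned for $(\xi^1,\dots,\xi^n)$, then the solution returned for $(\xi^{\pi(1)},\dots,\xi^{\pi(n)})$ has the same law over the seed as $(x^{\pi(1)},\dots,x^{\pi(n)})$ (for a deterministic solver: is equal to it). **Single-sample OSO.** In each period $t=1,\dots,T$: observe $\xi^t$; draw one sample path $\widetilde\xi^{t+1}_t,\dots,\widetilde\xi^{T}_t$, i.i.d. with law $\mathcal D$ and independent of everything else; with a fresh independent seed, run the solver on the items $\xi^t,\widetilde\xi^{t+1}_t,\dots,\widetilde\xi^T_t$ with the residual capacities $b-\sum_{\tau<t}(A^\tau)^\top\overline x^\tau$; implement the first component of its solution as the action $\overline x^t$ on item $\xi^t$, and discard the others. Its reward is $\mathrm{ALG}=\sum_{t=1}^T r^t\cdot\overline x^t$. **Theorem.** Let $\varepsilon\in(0,0.001]$ be such that, for every $(r,A)$ in the support of $\mathcal D$ and all $j\in\mathcal J$, $k\in\mathcal K$, $$b_k\;\ge\;1024\cdot\log\Big(\frac{2dT}{\varepsilon}\Big)\cdot\frac{\log^3(1/\varepsilon)}{\varepsilon^2}\cdot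 A_{jk}.$$ Then single-sample OSO with any equivariant solver has an integrable reward, with $$\mathbb E[\mathrm{ALG}]\;\ge\;(1-\varepsilon)\,\mathbb E[\mathrm{OPT}].$$ -/

import Mathlib

open MeasureTheory

namespace OnlineAllocation

/-- An item `ξ = (r, A)`: assigning it to the supply node `j` yields the reward `r j = ξ.1 j` and
consumes `A j k = ξ.2 j k` units of each resource `k`. -/
abbrev Item (J K : Type*) : Type _ := (J → ℝ) × (J → K → ℝ)

section Offline

variable {J K : Type*} [Fintype J]

/-- The action space for one item: 0/1 vectors over the supply nodes with at most one entry 1. -/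
def Actions (J : Type*) [Fintype J] : Set (J → ℝ) :=
  {x | (∀ j, x j = 0 ∨ x j = 1) ∧ ∑ j, x j ≤ 1}

/-- The reward `r · x` of the action `x` on one item. -/
def itemReward (ξ : Item J K) (x : J → ℝ) : ℝ := ∑ j, ξ.1 j * x j

/-- The resource consumption `Aᵀ x` of the action `x` on one item. -/
def itemUse (ξ : Item J K) (x : J → ℝ) : K → ℝ := fun k => ∑ j, ξ.2 j k * x j

/-- Feasibility of the assignment `x` of `n` items under the capacities `b`. -/
def Feasible {n : ℕ} (ξ : Fin n → Item J K) (b : K → ℝ) (x : Fin n → J → ℝ) : Prop :=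
  (∀ t, x t ∈ Actions J) ∧ ∀ k, ∑ t, itemUse (ξ t) (x t) k ≤ b k

/-- Total reward of an assignment. -/
def totalReward {n : ℕ} (ξ : Fin n → Item J K) (x : Fin n → J → ℝ) : ℝ :=
  ∑ t, itemReward (ξ t) (x t)

/-- `x` is an optimal solution of the offline resource allocation problem. -/
def IsOptimal {n : ℕ} (ξ : Fin n → Item J K) (b : K → ℝ) (x : Fin n → J → ℝ) : Prop :=
  Feasible ξ b x ∧ ∀ y, Feasible ξ b y → totalReward ξ y ≤ totalReward ξ x

/-- The optimal value `OPT` of the offline problem (a supremum over a finite set of values). -/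
noncomputable def offlineOpt {n : ℕ} (b : K → ℝ) (ξ : Fin n → Item J K) : ℝ :=
  sSup {v | ∃ x, Feasible ξ b x ∧ totalReward ξ x = v}

end Offline

/-- An integer programming solver, possibly using a random seed in `S` (for instance to break ties):
for every seed it returns an optimal solution of every feasible instance, and it depends
measurably on the seed and the data. A deterministic solver is the case of a one-point `S`. -/
structure Solver (J K S : Type*) [Fintype J] [MeasurableSpace S] where
  solve : S → (n : ℕ) → (Fin n → Item J K) → (K → ℝ) → (Fin n → J → ℝ)
  measurable_solve : ∀ n, Measurable
    (fun p : S × (Fin n → Item J K) × (K → ℝ) => solve p.1 n p.2.1 p.2.2)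
  optimal : ∀ (s : S) (n : ℕ) (ξ : Fin n → Item J K) (b : K → ℝ),
    (∃ x, Feasible ξ b x) → IsOptimal ξ b (solve s n ξ b)

section Online

variable {J K S : Type*} [Fintype J] [MeasurableSpace S]

/-- The solver is equivariant, for seeds of law `ν`: permuting the items permutes the returned
solution the same way, in law over the seed. For a deterministic solver this is equality of the
solutions. (Equality in law is needed because no deterministic choice can be equivariant on
instances with identical items of which only some can be accepted.) -/
def Solver.IsEquivariant (σ : Solver J K S) (ν : Measure S) : Prop :=
  ∀ (n : ℕ) (ξ : Fin n → Item J K) (b : K → ℝ), (∃ x, Feasible ξ b x) →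
    ∀ π : Equiv.Perm (Fin n),
      ν.map (fun s => σ.solve s n (fun i => ξ (π i)) b) =
        ν.map (fun s => fun i => σ.solve s n ξ b (π i))

/-- All the randomness of a run of single-sample OSO over `T` periods (numbered from 0):
the arriving items `ξ t`, the sampled items `ξ̃ t τ` (the sample drawn in period `t` for the
period `τ`; only those with `t < τ` are used), and the solver's seed in each period. -/
abbrev Scenario (J K S : Type*) (T : ℕ) : Type _ :=
  (Fin T → Item J K) × (Fin T → Fin T → Item J K) × (Fin T → S)

/-- Arriving items and samples are all i.i.d. with law `D`, and independent of the seeds, which are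
i.i.d. with law `ν`. -/
noncomputable def scenarioLaw (D : Measure (Item J K)) (ν : Measure S) (T : ℕ) :
    Measure (Scenario J K S T) :=
  (Measure.pi fun _ : Fin T => D).prod
    ((Measure.pi fun _ : Fin T => Measure.pi fun _ : Fin T => D).prod
      (Measure.pi fun _ : Fin T => ν))

variable {T : ℕ}

/-- The items of the problem solved in period `t`: the arrived item, then the samples for
the periods `t + 1, …, T - 1`. -/
def stageItems (ω : Scenario J K S T) (t : Fin T) : Fin (T - t) → Item J K :=
  fun i => if i.val = 0 then ω.1 t else ω.2.1 t ⟨t + i, by omega⟩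

/-- The action that OSO implements in period `t` when the resources `u` have been used before:
the first component of the solver's solution with the residual capacities `b - u`. -/
def stageAction (σ : Solver J K S) (b : K → ℝ) (ω : Scenario J K S T) (t : Fin T) (u : K → ℝ) :
    J → ℝ :=
  σ.solve (ω.2.2 t) (T - t) (stageItems ω t) (b - u) ⟨0, by omega⟩

/-- The resources used by OSO in the periods before `t`. -/
def osoUsed (σ : Solver J K S) (b : K → ℝ) (ω : Scenario J K S T) : ℕ → K → ℝ
  | 0 => 0
  | t + 1 =>
    if h : t < T then
      osoUsed σ b ω t + itemUse (ω.1 ⟨t, h⟩) (stageAction σ b ω ⟨t, h⟩ (osoUsed σ b ω t))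
    else osoUsed σ b ω t

/-- The action implemented by single-sample OSO in period `t`. -/
def osoAction (σ : Solver J K S) (b : K → ℝ) (ω : Scenario J K S T) (t : Fin T) : J → ℝ :=
  stageAction σ b ω t (osoUsed σ b ω t)

/-- The total reward collected by single-sample OSO. -/
def osoReward (σ : Solver J K S) (b : K → ℝ) (ω : Scenario J K S T) : ℝ :=
  totalReward ω.1 (osoAction σ b ω)

end Online

end OnlineAllocation

/-! Write `n = T - t` for the number of items in the instance solved in period `t`, and let `R`
satisfy `R * A j k ≤ b k`. Given the residual capacities `B`, this instance is i.i.d. and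
independent of the past (`map_stage`, `integral_stage`). Equivariance makes its items exchangeable
together with their actions (`Solver.IsEquivariant.map_eq`). Hence the implemented first action
earns exactly `1 / n` of the expected optimal value and uses at most `B k / n` of resource `k` in
expectation. Two facts remain to be shown.

Capacities last. The remaining fraction of a resource loses at most a share `1 / n` of itself in
conditional mean, so it should stay near `n / T`. An exponential supermartingale with a
time-dependent exponent bounds the probability that it falls below `(1 - 4 μ) n / T` by `exp (-2 R
(n / T) μ²)` (`measure_remaining_lt_le`).

Short instances are worth their share. If every `B k` is at least `(1 - γ / 4) (n / T) b k`, treat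
each item independently as a `T`-item instance would, but reject it with extra probability `γ`. This
uses `(1 - γ) (n / T) b k` in expectation at most, which leaves slack of order `γ`. Charging
overflows by exponential moments gives the optimum at least `(1 - γ) (1 - δ)` times its share `n /
T` of `E[OPT]` (`integral_iid_penalized`, `Solver.IsEquivariant.le_integral_itemReward`).

Period `t` therefore earns at least `(1 - γ - 2 δ) E[OPT] / T`, provided that `(n / T) R γ²` is at
least of order `log (d / δ)`. Choosing `γ = (ε / 8) √(T / n)` makes this requirement the same in all
periods, and the average of `√(T / n)` is at most 2, so the losses add up to less than `ε`. -/

namespace OnlineAllocation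

/-! ### Product measures: resampling, reindexing, regrouping. -/

section MeasureLemmas

variable {ι α β γ δ : Type*} [MeasurableSpace α] [MeasurableSpace β] [MeasurableSpace γ]
  [MeasurableSpace δ]

/-- Resampling one coordinate preserves a product probability measure. -/
theorem measurePreserving_update [Fintype ι] [DecidableEq ι] (μ : Measure α)
    [IsProbabilityMeasure μ] (t : ι) :
    MeasurePreserving (fun p : (ι → α) × α => Function.update p.1 t p.2)
      ((Measure.pi fun _ => μ).prod μ) (Measure.pi fun _ => μ) := by
  have hm : Measurable (fun p : (ι → α) × α => Function.update p.1 t p.2) := by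
    refine measurable_pi_lambda _ fun i => ?_
    by_cases h : i = t
    · subst h; simpa using measurable_snd
    · simp only [Function.update_of_ne h]
      fun_prop
  refine ⟨hm, (Measure.pi_eq fun s hs => ?_).symm⟩
  rw [Measure.map_apply hm (MeasurableSet.univ_pi hs)]
  have : (fun p : (ι → α) × α => Function.update p.1 t p.2) ⁻¹' Set.univ.pi s =
      (Set.univ.pi (Function.update s t Set.univ)) ×ˢ s t := by
    ext p
    simp only [Set.mem_preimage, Set.mem_univ_pi, Set.mem_prod]
    constructor
    · intro h
      refine ⟨fun i => ?_, by simpa using h t⟩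
      by_cases hi : i = t
      · subst hi; simp
      · simpa [Function.update_of_ne hi] using h i
    · rintro ⟨h, h'⟩ i
      by_cases hi : i = t
      · subst hi; simpa using h'
      · simpa [Function.update_of_ne hi] using h i
  rw [this, Measure.prod_prod, Measure.pi_pi,
    ← Finset.mul_prod_erase Finset.univ _ (Finset.mem_univ t),
    ← Finset.mul_prod_erase Finset.univ (fun i => μ (s i)) (Finset.mem_univ t)]
  simp only [Function.update_self, measure_univ, one_mul]
  rw [mul_comm]
  congr 1
  refine Finset.prod_congr rfl fun i hi => ?_
  rw [Function.update_of_ne (Finset.ne_of_mem_erase hi)]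

/-- Reindexing i.i.d. coordinates along an injection gives i.i.d. coordinates. -/
theorem measurePreserving_reindex [Fintype ι] {κ : Type*} [Fintype κ] (μ : Measure α)
    [IsProbabilityMeasure μ] {f : κ → ι} (hf : f.Injective) :
    MeasurePreserving (fun (x : ι → α) k => x (f k))
      (Measure.pi fun _ => μ) (Measure.pi fun _ => μ) := by
  refine ⟨by fun_prop, ?_⟩
  have h : ProbabilityTheory.iIndepFun (fun i (x : ι → α) => x i) (Measure.pi fun _ : ι => μ) :=
    ProbabilityTheory.iIndepFun_pi (X := fun _ x => x) fun _ => aemeasurable_id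
  have h2 := (ProbabilityTheory.iIndepFun_iff_map_fun_eq_pi_map
    fun k => (measurable_pi_apply (f k)).aemeasurable).1 (h.precomp hf)
  rw [h2]
  congr 1
  ext1 k
  exact (measurePreserving_eval (fun _ : ι => μ) (f k)).map_eq

/-- Needed to pair each component of a scenario with its own fresh replacement when one period is
resampled. -/
theorem measurePreserving_prodProdProdComm (μ₁ : Measure α) (μ₂ : Measure β) (μ₃ : Measure γ)
    (μ₄ : Measure δ) [SFinite μ₁] [SFinite μ₂] [SFinite μ₃] [SFinite μ₄] :
    MeasurePreserving (fun p : (α × β) × γ × δ => ((p.1.1, p.2.1), (p.1.2, p.2.2)))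
      ((μ₁.prod μ₂).prod (μ₃.prod μ₄)) ((μ₁.prod μ₃).prod (μ₂.prod μ₄)) := by
  have hm : Measurable (fun p : (α × β) × γ × δ => ((p.1.1, p.2.1), (p.1.2, p.2.2))) := by
    fun_prop
  refine ⟨hm, Measure.ext_of_lintegral _ fun f hf => ?_⟩
  rw [lintegral_map hf hm, lintegral_prod _ (by fun_prop),
    lintegral_prod _ hf.aemeasurable]
  simp only
  rw [lintegral_prod _ (by fun_prop), lintegral_prod _ (by fun_prop)]
  refine lintegral_congr fun a => ?_
  simp only
  have h1 : ∀ y : β, ∫⁻ z : γ × δ, f ((a, z.1), y, z.2) ∂(μ₃.prod μ₄) =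
      ∫⁻ z, ∫⁻ w, f ((a, z), y, w) ∂μ₄ ∂μ₃ := fun y =>
    lintegral_prod _ (by fun_prop)
  have h2 : ∀ z : γ, ∫⁻ y : β × δ, f ((a, z), y.1, y.2) ∂(μ₂.prod μ₄) =
      ∫⁻ y, ∫⁻ w, f ((a, z), y, w) ∂μ₄ ∂μ₂ := fun y =>
    lintegral_prod _ (by fun_prop)
  simp only [h1]
  simp only [Prod.mk.eta] at h2
  simp only [h2]
  exact lintegral_lintegral_swap (by
    apply Measurable.aemeasurable
    apply Measurable.lintegral_prod_right'
      (f := fun q : (β × γ) × δ => f ((a, q.1.2), q.1.1, q.2))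
    fun_prop)

end MeasureLemmas

/-! ### Elementary exponential estimates and a sum of inverse square roots. -/

theorem exp_mul_le_chord (η : ℝ) {w : ℝ} (h0 : 0 ≤ w) (h1 : w ≤ 1) :
    Real.exp (η * w) ≤ 1 + (Real.exp η - 1) * w := by
  have := convexOn_exp.2 (Set.mem_univ 0) (Set.mem_univ η) (sub_nonneg.2 h1) h0 (by ring)
  simp only [smul_eq_mul, mul_zero, zero_add, Real.exp_zero, mul_one] at this
  rw [mul_comm η]
  linarith

theorem exp_sub_one_le_add_sq {η : ℝ} (h0 : 0 ≤ η) (h1 : η ≤ 1) :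
    Real.exp η - 1 ≤ η + η ^ 2 := by
  have := Real.abs_exp_sub_one_sub_id_le (x := η) (by rwa [abs_of_nonneg h0])
  linarith [le_abs_self (Real.exp η - 1 - η)]

/-- Moment generating function bound for `[0, 1]`-valued variables of mean at most `m`. -/
theorem integral_exp_mul_le {Ω : Type*} [MeasurableSpace Ω] {P : Measure Ω}
    [IsProbabilityMeasure P] {w : Ω → ℝ} (hw : AEStronglyMeasurable w P)
    (h01 : ∀ᵐ x ∂P, 0 ≤ w x ∧ w x ≤ 1) {η m : ℝ} (h0 : 0 ≤ η) (h1 : η ≤ 1)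
    (hm : ∫ x, w x ∂P ≤ m) :
    ∫ x, Real.exp (η * w x) ∂P ≤ Real.exp ((η + η ^ 2) * m) := by
  have hint : Integrable w P := Integrable.of_bound hw 1 (by
    filter_upwards [h01] with x hx
    rw [Real.norm_of_nonneg hx.1]; exact hx.2)
  have hm0 : 0 ≤ ∫ x, w x ∂P := integral_nonneg_of_ae (h01.mono fun x hx => hx.1)
  calc ∫ x, Real.exp (η * w x) ∂P ≤ ∫ x, (1 + (Real.exp η - 1) * w x) ∂P := by
        refine integral_mono_of_nonneg (.of_forall fun _ => (Real.exp_pos _).le)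
          ((integrable_const _).add (hint.const_mul _)) ?_
        filter_upwards [h01] with x hx using exp_mul_le_chord η hx.1 hx.2
    _ = 1 + (Real.exp η - 1) * ∫ x, w x ∂P := by
        rw [integral_add (integrable_const _) (hint.const_mul _), integral_const_mul]
        simp
    _ ≤ 1 + (η + η ^ 2) * m := by
        have := exp_sub_one_le_add_sq h0 h1
        gcongr
    _ ≤ _ := by linarith [Real.add_one_le_exp ((η + η ^ 2) * m)]

/-- The loss in a period is proportional to `√(T / (T - t))`; this says that such losses average to
a constant. The sum telescopes, since `1 / √(n + 1) ≤ 2 √(n + 1) - 2 √n`. -/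
theorem sum_sqrt_div_le (T : ℕ) :
    ∑ t : Fin T, √((T : ℝ) / ((T - t : ℕ) : ℝ)) ≤ 2 * T := by
  have key : ∀ n : ℕ, ∑ i ∈ Finset.range n, 1 / √((i + 1 : ℕ) : ℝ) ≤ 2 * √n := by
    intro n
    induction n with
    | zero => simp
    | succ n ih =>
      rw [Finset.sum_range_succ]
      have hp : 0 < √((n + 1 : ℕ) : ℝ) := Real.sqrt_pos.2 (by positivity)
      have h1 : √((n + 1 : ℕ) : ℝ) ^ 2 = n + 1 := by
        rw [Real.sq_sqrt (by positivity)]; push_cast; ring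
      have h2 : √(n : ℝ) ^ 2 = n := Real.sq_sqrt (by positivity)
      have h3 : 1 / √((n + 1 : ℕ) : ℝ) ≤ 2 * √((n + 1 : ℕ) : ℝ) - 2 * √(n : ℝ) := by
        rw [div_le_iff₀ hp]
        nlinarith [sq_nonneg (√((n + 1 : ℕ) : ℝ) - √(n : ℝ))]
      linarith
  have h1 : ∑ t : Fin T, √((T : ℝ) / ((T - t : ℕ) : ℝ)) =
      √T * ∑ i ∈ Finset.range T, 1 / √((i + 1 : ℕ) : ℝ) := by
    rw [Finset.sum_fin_eq_sum_range, ← Finset.sum_range_reflect, Finset.mul_sum]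
    refine Finset.sum_congr rfl fun i hi => ?_
    have hi := Finset.mem_range.1 hi
    rw [dif_pos (by omega), Real.sqrt_div (by positivity), show T - (T - 1 - i) = i + 1 by omega]
    ring
  rw [h1]
  have := mul_le_mul_of_nonneg_left (key T) (Real.sqrt_nonneg T)
  have h2 : √(T : ℝ) ^ 2 = T := Real.sq_sqrt (by positivity)
  nlinarith

/-! ### Offline instances and the single-item optimum. -/

section OfflineLemmas

variable {J K : Type*} [Fintype J]

theorem zero_mem_actions : (0 : J → ℝ) ∈ Actions J := by
  simp [Actions]

theorem Actions.nonneg {x : J → ℝ} (hx : x ∈ Actions J) (j : J) : 0 ≤ x j := by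
  rcases hx.1 j with h | h <;> simp [h]

@[simp] theorem itemReward_zero (ξ : Item J K) : itemReward ξ 0 = 0 := by simp [itemReward]

@[simp] theorem itemUse_zero (ξ : Item J K) : itemUse ξ 0 = 0 := by ext; simp [itemUse]

theorem itemUse_nonneg {ξ : Item J K} (hξ : ∀ j k, 0 ≤ ξ.2 j k) {x : J → ℝ}
    (hx : x ∈ Actions J) (k : K) : 0 ≤ itemUse ξ x k :=
  Finset.sum_nonneg fun j _ => mul_nonneg (hξ j k) (Actions.nonneg hx j)

theorem itemUse_le {ξ : Item J K} {x : J → ℝ} (hx : x ∈ Actions J) {k : K} {c : ℝ} (hc : 0 ≤ c)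
    (h : ∀ j, ξ.2 j k ≤ c) : itemUse ξ x k ≤ c :=
  calc itemUse ξ x k ≤ ∑ j, c * x j :=
        Finset.sum_le_sum fun j _ => mul_le_mul_of_nonneg_right (h j) (Actions.nonneg hx j)
    _ = c * ∑ j, x j := by rw [Finset.mul_sum]
    _ ≤ c := mul_le_of_le_one_right hc hx.2

theorem feasible_zero {n : ℕ} (ξ : Fin n → Item J K) {b : K → ℝ} (hb : 0 ≤ b) :
    Feasible ξ b 0 :=
  ⟨fun _ => zero_mem_actions, fun k => by simpa using hb k⟩

theorem Feasible.itemUse_le {n : ℕ} {ξ : Fin n → Item J K} {b : K → ℝ} {x : Fin n → J → ℝ}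
    (h : Feasible ξ b x) (hξ : ∀ t j k, 0 ≤ (ξ t).2 j k) (t : Fin n) (k : K) :
    itemUse (ξ t) (x t) k ≤ b k :=
  (Finset.single_le_sum (f := fun t => itemUse (ξ t) (x t) k)
    (fun s _ => itemUse_nonneg (hξ s) (h.1 s) k) (Finset.mem_univ t)).trans (h.2 k)

theorem IsOptimal.offlineOpt_eq {n : ℕ} {ξ : Fin n → Item J K} {b : K → ℝ} {x : Fin n → J → ℝ}
    (h : IsOptimal ξ b x) : offlineOpt b ξ = totalReward ξ x :=
  IsGreatest.csSup_eq ⟨⟨x, h.1, rfl⟩, by rintro _ ⟨y, hy, rfl⟩; exact h.2 y hy⟩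

/-- Rejecting item `t` frees resources, as consumptions are non-negative, so it stays feasible and
cannot improve an optimum. -/
theorem IsOptimal.itemReward_nonneg {n : ℕ} {ξ : Fin n → Item J K} {b : K → ℝ}
    {x : Fin n → J → ℝ} (h : IsOptimal ξ b x) (hξ : ∀ t j k, 0 ≤ (ξ t).2 j k) (t : Fin n) :
    0 ≤ itemReward (ξ t) (x t) := by
  have hf : Feasible ξ b (Function.update x t 0) := by
    refine ⟨fun s => ?_, fun k => le_trans (Finset.sum_le_sum fun s _ => ?_) (h.1.2 k)⟩
    · by_cases hs : s = t
      · subst hs; simpa using zero_mem_actions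
      · simpa [Function.update_of_ne hs] using h.1.1 s
    · by_cases hs : s = t
      · subst hs; simpa using itemUse_nonneg (hξ s) (h.1.1 s) k
      · simp [Function.update_of_ne hs]
  have h2 := h.2 _ hf
  unfold totalReward at h2
  rw [← Finset.add_sum_erase _ _ (Finset.mem_univ t),
    ← Finset.add_sum_erase _ (fun s => itemReward (ξ s) (x s)) (Finset.mem_univ t)] at h2
  have h3 : ∑ s ∈ Finset.univ.erase t, itemReward (ξ s) (Function.update x t 0 s) =
      ∑ s ∈ Finset.univ.erase t, itemReward (ξ s) (x s) :=
    Finset.sum_congr rfl fun s hs => by rw [Function.update_of_ne (Finset.ne_of_mem_erase hs)]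
  rw [h3] at h2
  simp only [Function.update_self, itemReward_zero] at h2
  linarith

theorem feasible_single {n : ℕ} (ξ : Fin n → Item J K) {b : K → ℝ} (t : Fin n) {x : J → ℝ}
    (hx : x ∈ Actions J) (hu : ∀ k, itemUse (ξ t) x k ≤ b k) :
    Feasible ξ b (Function.update 0 t x) := by
  refine ⟨fun s => ?_, fun k => ?_⟩
  · by_cases hs : s = t
    · subst hs; simpa using hx
    · simpa [Function.update_of_ne hs] using zero_mem_actions
  · rw [Finset.sum_eq_single t]
    · simpa using hu k
    · intro s _ hs; simp [Function.update_of_ne hs]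
    · simp

theorem totalReward_single {n : ℕ} (ξ : Fin n → Item J K) (t : Fin n) (x : J → ℝ) :
    totalReward ξ (Function.update 0 t x) = itemReward (ξ t) x := by
  unfold totalReward
  rw [Finset.sum_eq_single t]
  · simp
  · intro s _ hs; simp [Function.update_of_ne hs]
  · simp

theorem measurable_itemReward :
    Measurable (fun p : Item J K × (J → ℝ) => itemReward p.1 p.2) := by
  unfold itemReward; fun_prop

theorem measurable_itemUse :
    Measurable (fun p : Item J K × (J → ℝ) => itemUse p.1 p.2) := by
  unfold itemUse; fun_prop

variable {S : Type*} [MeasurableSpace S]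

theorem Solver.measurable_comp (σ : Solver J K S) {Ω : Type*} [MeasurableSpace Ω] {n : ℕ}
    {s : Ω → S} {ξ : Ω → Fin n → Item J K} {B : Ω → K → ℝ} (hs : Measurable s)
    (hξ : Measurable ξ) (hB : Measurable B) (i : Fin n) :
    Measurable fun ω => σ.solve (s ω) n (ξ ω) (B ω) i :=
  (measurable_pi_apply i).comp ((σ.measurable_solve n).comp (hs.prodMk (hξ.prodMk hB)))

/-- The best reward of a single item with capacities `b`. -/
def Solver.singleOpt (σ : Solver J K S) (s : S) (b : K → ℝ) (ξ : Item J K) : ℝ :=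
  itemReward ξ (σ.solve s 1 (fun _ => ξ) b 0)

theorem Solver.measurable_singleOpt (σ : Solver J K S) (s : S) (b : K → ℝ) :
    Measurable (σ.singleOpt s b) :=
  measurable_itemReward.comp (measurable_id.prodMk
    (σ.measurable_comp measurable_const (by fun_prop) measurable_const 0))

/-- With `Solver.singleOpt_le_offlineOpt` this sandwiches rewards: `singleOpt` dominates any reward
that one item can earn within `b`, and is itself dominated by `OPT`. All integrability of rewards
comes from here; defining `singleOpt` through the solver makes its measurability free. -/
theorem Solver.itemReward_le_singleOpt (σ : Solver J K S) (s : S) {b : K → ℝ} {ξ : Item J K}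
    {x : J → ℝ} (hx : x ∈ Actions J) (hu : ∀ k, itemUse ξ x k ≤ b k) :
    itemReward ξ x ≤ σ.singleOpt s b ξ := by
  have hf : Feasible (fun _ : Fin 1 => ξ) b (fun _ => x) := ⟨fun _ => hx, by simpa using hu⟩
  simpa [totalReward, Solver.singleOpt] using (σ.optimal s 1 (fun _ => ξ) b ⟨_, hf⟩).2 _ hf

theorem Solver.singleOpt_nonneg (σ : Solver J K S) (s : S) {b : K → ℝ} (hb : 0 ≤ b)
    (ξ : Item J K) : 0 ≤ σ.singleOpt s b ξ := by
  simpa using σ.itemReward_le_singleOpt s (ξ := ξ) zero_mem_actions (by simpa using Pi.le_def.1 hb)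

theorem Solver.singleOpt_le_offlineOpt (σ : Solver J K S) (s : S) {b : K → ℝ} (hb : 0 ≤ b)
    {n : ℕ} (ξ : Fin n → Item J K) (t : Fin n) :
    σ.singleOpt s b (ξ t) ≤ offlineOpt b ξ := by
  have h1 := (σ.optimal s 1 (fun _ => ξ t) b ⟨0, feasible_zero _ hb⟩).1
  have hf := feasible_single ξ t (h1.1 0) (by simpa using h1.2)
  have hopt := σ.optimal s n ξ b ⟨_, hf⟩
  rw [hopt.offlineOpt_eq]
  have := hopt.2 _ hf
  rwa [totalReward_single] at this

end OfflineLemmas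

/-! ### Consequences of equivariance on i.i.d. instances. -/

section Exchangeable

variable {J K S : Type*} [Fintype J] [MeasurableSpace S]
  {D : Measure (Item J K)} [IsProbabilityMeasure D] {ν : Measure S} [IsProbabilityMeasure ν]

theorem ae_pi_of_ae {α : Type*} [MeasurableSpace α] {μ : Measure α} [IsProbabilityMeasure μ]
    {ι : Type*} [Fintype ι] {p : α → Prop} (h : ∀ᵐ x ∂μ, p x) :
    ∀ᵐ x ∂(Measure.pi fun _ : ι => μ), ∀ i, p (x i) :=
  ae_all_iff.2 fun i =>
    (measurePreserving_eval (fun _ : ι => μ) i).quasiMeasurePreserving.ae h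

theorem ae_prod_fst {α β : Type*} [MeasurableSpace α] [MeasurableSpace β] {μ : Measure α}
    {ν : Measure β} [IsProbabilityMeasure ν] {p : α → Prop} (h : ∀ᵐ x ∂μ, p x) :
    ∀ᵐ x ∂(μ.prod ν), p x.1 :=
  Measure.quasiMeasurePreserving_fst.ae h

/-- For an equivariant solver all items of an i.i.d. instance are treated alike. -/
theorem Solver.IsEquivariant.map_eq {σ : Solver J K S} (hσ : σ.IsEquivariant ν) {n : ℕ}
    {B : K → ℝ} (hB : 0 ≤ B) (i j : Fin n) :
    Measure.map (fun p : (Fin n → Item J K) × S => (p.1 i, σ.solve p.2 n p.1 B i))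
        ((Measure.pi fun _ => D).prod ν) =
      Measure.map (fun p : (Fin n → Item J K) × S => (p.1 j, σ.solve p.2 n p.1 B j))
        ((Measure.pi fun _ => D).prod ν) := by
  have hm : ∀ i, Measurable
      (fun p : (Fin n → Item J K) × S => (p.1 i, σ.solve p.2 n p.1 B i)) := fun i =>
    ((measurable_pi_apply i).comp measurable_fst).prodMk
      (σ.measurable_comp measurable_snd measurable_fst measurable_const i)
  refine Measure.ext_of_lintegral _ fun g hg => ?_
  have hgm : ∀ i, Measurable
      (fun p : (Fin n → Item J K) × S => g (p.1 i, σ.solve p.2 n p.1 B i)) := fun i =>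
    hg.comp (hm i)
  rw [lintegral_map hg (hm i), lintegral_map hg (hm j), lintegral_prod _ (hgm i).aemeasurable,
    lintegral_prod _ (hgm j).aemeasurable]
  -- Swapping items `i` and `j` preserves the law of the instance. For a fixed instance,
  -- equivariance then turns the action on item `i` of the swapped instance into that on item `j` of
  -- the original one, in law over the seed.
  have hπ := measurePreserving_reindex D (Equiv.swap i j).injective
  rw [← hπ.lintegral_comp (hgm i).lintegral_prod_right']
  refine lintegral_congr fun ξ => ?_
  have hG : Measurable fun x : Fin n → J → ℝ => g (ξ j, x i) := by fun_prop
  have hs : ∀ ξ : Fin n → Item J K, Measurable fun s => σ.solve s n ξ B := fun ξ =>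
    measurable_pi_lambda _ fun i =>
      σ.measurable_comp measurable_id measurable_const measurable_const i
  have h := congrArg (fun μ => ∫⁻ x, g (ξ j, x i) ∂μ)
    (hσ n ξ B ⟨0, feasible_zero _ hB⟩ (Equiv.swap i j))
  have hsw : Measurable fun s => fun k => σ.solve s n ξ B (Equiv.swap i j k) :=
    measurable_pi_lambda _ fun k => (measurable_pi_apply (Equiv.swap i j k)).comp (hs ξ)
  rw [lintegral_map hG (hs _), lintegral_map hG hsw] at h
  simpa using h

/-- The total over all items is `n` times that of any fixed item, in expectation. -/
theorem Solver.IsEquivariant.integral_sum {σ : Solver J K S} (hσ : σ.IsEquivariant ν) {n : ℕ}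
    {B : K → ℝ} (hB : 0 ≤ B) (i₀ : Fin n) {f : Item J K × (J → ℝ) → ℝ} (hf : Measurable f)
    (hint : Integrable (fun p : (Fin n → Item J K) × S => f (p.1 i₀, σ.solve p.2 n p.1 B i₀))
      ((Measure.pi fun _ => D).prod ν)) :
    ∫ p : (Fin n → Item J K) × S, ∑ i, f (p.1 i, σ.solve p.2 n p.1 B i)
        ∂((Measure.pi fun _ => D).prod ν) =
      n * ∫ p : (Fin n → Item J K) × S, f (p.1 i₀, σ.solve p.2 n p.1 B i₀)
        ∂((Measure.pi fun _ => D).prod ν) := by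
  have hm : ∀ i, AEMeasurable
      (fun p : (Fin n → Item J K) × S => (p.1 i, σ.solve p.2 n p.1 B i))
      ((Measure.pi fun _ => D).prod ν) := fun i =>
    (((measurable_pi_apply i).comp measurable_fst).prodMk
      (σ.measurable_comp measurable_snd measurable_fst measurable_const i)).aemeasurable
  have hi : ∀ i, Integrable
      (fun p : (Fin n → Item J K) × S => f (p.1 i, σ.solve p.2 n p.1 B i))
      ((Measure.pi fun _ => D).prod ν) := fun i => by
    have h1 := (integrable_map_measure (g := f) hf.aestronglyMeasurable (hm i₀)).2 hint
    rw [hσ.map_eq hB i₀ i] at h1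
    exact (integrable_map_measure hf.aestronglyMeasurable (hm i)).1 h1
  rw [integral_finsetSum _ fun i _ => hi i, Finset.sum_congr rfl
    (g := fun _ => ∫ p : (Fin n → Item J K) × S, f (p.1 i₀, σ.solve p.2 n p.1 B i₀)
        ∂((Measure.pi fun _ => D).prod ν))]
  · simp
  · intro i _
    rw [← integral_map (hm i) hf.aestronglyMeasurable, hσ.map_eq hB i i₀,
      integral_map (hm i₀) hf.aestronglyMeasurable]

theorem Solver.isOptimal_solve (σ : Solver J K S) {n : ℕ} {B : K → ℝ} (hB : 0 ≤ B)
    (s : S) (ξ : Fin n → Item J K) : IsOptimal ξ B (σ.solve s n ξ B) :=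
  σ.optimal s n ξ B ⟨0, feasible_zero _ hB⟩

theorem Solver.integrable_singleOpt (σ : Solver J K S) (s : S) {b : K → ℝ} (hb : 0 ≤ b) {T : ℕ}
    (hT : 0 < T) (hOPT : Integrable (fun ξ : Fin T → Item J K => offlineOpt b ξ)
      (Measure.pi fun _ : Fin T => D)) : Integrable (σ.singleOpt s b) D := by
  have he := measurePreserving_eval (fun _ : Fin T => D) ⟨0, hT⟩
  rw [← he.integrable_comp (σ.measurable_singleOpt s b).aestronglyMeasurable]
  refine hOPT.mono' (by
    exact ((σ.measurable_singleOpt s b).comp he.measurable).aestronglyMeasurable)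
    (.of_forall fun ξ => ?_)
  rw [Function.comp_apply, Real.norm_of_nonneg (σ.singleOpt_nonneg s hb _)]
  exact σ.singleOpt_le_offlineOpt s hb ξ _

/-- Integrability of the reward of one item of an i.i.d. instance. -/
theorem Solver.integrable_itemReward (σ : Solver J K S) {s₀ : S} {b B : K → ℝ}
    (hA : ∀ᵐ ξ ∂D, ∀ j k, 0 ≤ ξ.2 j k) (hB : 0 ≤ B) (hBb : B ≤ b)
    (hs : Integrable (σ.singleOpt s₀ b) D) {n : ℕ} (i : Fin n) :
    Integrable (fun p : (Fin n → Item J K) × S => itemReward (p.1 i) (σ.solve p.2 n p.1 B i))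
      ((Measure.pi fun _ => D).prod ν) := by
  have h1 : Integrable (fun p : (Fin n → Item J K) × S => σ.singleOpt s₀ b (p.1 i))
      ((Measure.pi fun _ => D).prod ν) :=
    (((measurePreserving_eval (fun _ : Fin n => D) i).comp
      measurePreserving_fst).integrable_comp
        (σ.measurable_singleOpt s₀ b).aestronglyMeasurable).2 hs
  refine h1.mono' (measurable_itemReward.comp (((measurable_pi_apply i).comp
    measurable_fst).prodMk (σ.measurable_comp measurable_snd measurable_fst measurable_const
      i))).aestronglyMeasurable ?_
  filter_upwards [ae_prod_fst (ν := ν) (ae_pi_of_ae (ι := Fin n) hA)] with p hp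
  have ho := σ.isOptimal_solve hB p.2 p.1
  rw [Real.norm_of_nonneg (ho.itemReward_nonneg hp i)]
  exact σ.itemReward_le_singleOpt s₀ (ho.1.1 i) fun k => (ho.1.itemUse_le hp i k).trans (hBb k)

/-- The expected consumption of one item is at most its share of the capacity. -/
theorem Solver.IsEquivariant.integral_itemUse_le {σ : Solver J K S} (hσ : σ.IsEquivariant ν)
    {B : K → ℝ} (hA : ∀ᵐ ξ ∂D, ∀ j k, 0 ≤ ξ.2 j k) (hB : 0 ≤ B) {n : ℕ} (i : Fin n) (k : K) :
    ∫ p : (Fin n → Item J K) × S, itemUse (p.1 i) (σ.solve p.2 n p.1 B i) k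
      ∂((Measure.pi fun _ => D).prod ν) ≤ B k / n := by
  have hm : Measurable (fun p : Item J K × (J → ℝ) => itemUse p.1 p.2 k) :=
    (measurable_pi_apply k).comp measurable_itemUse
  have hae := ae_prod_fst (ν := ν) (ae_pi_of_ae (ι := Fin n) hA)
  have hint : Integrable
      (fun p : (Fin n → Item J K) × S => itemUse (p.1 i) (σ.solve p.2 n p.1 B i) k)
      ((Measure.pi fun _ => D).prod ν) := by
    refine Integrable.of_bound (hm.comp (((measurable_pi_apply i).comp
      measurable_fst).prodMk (σ.measurable_comp measurable_snd measurable_fst measurable_const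
      i))).aestronglyMeasurable (B k) ?_
    filter_upwards [hae] with p hp
    have ho := (σ.isOptimal_solve hB p.2 p.1).1
    rw [Real.norm_of_nonneg (itemUse_nonneg (hp i) (ho.1 i) k)]
    exact ho.itemUse_le hp i k
  have h := hσ.integral_sum hB i hm hint
  have hn : (0 : ℝ) < n := by exact_mod_cast i.pos
  rw [le_div_iff₀ hn, mul_comm]
  simp only at h
  rw [← h]
  calc _ ≤ ∫ _ : (Fin n → Item J K) × S, B k ∂((Measure.pi fun _ => D).prod ν) := by
        refine integral_mono_of_nonneg ?_ (integrable_const _) ?_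
        · filter_upwards [hae] with p hp
          exact Finset.sum_nonneg fun t _ =>
            itemUse_nonneg (hp t) ((σ.isOptimal_solve hB p.2 p.1).1.1 t) k
        · exact .of_forall fun p => (σ.isOptimal_solve hB p.2 p.1).1.2 k
    _ = B k := by simp

end Exchangeable

/-! ### The value of an instance with `n` items. -/

/-- Accepting i.i.d. plays and giving up everything when some cumulative consumption exceeds `c`
loses little: the loss is controlled by exponential moments. -/
theorem integral_iid_penalized {Z K : Type*} [MeasurableSpace Z] [Fintype K] {Q : Measure Z}
    [IsProbabilityMeasure Q] {r : Z → ℝ} (hr : Integrable r Q) (hr0 : ∀ᵐ z ∂Q, 0 ≤ r z)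
    {w : K → Z → ℝ} (hw : ∀ k, Measurable (w k)) (hw01 : ∀ᵐ z ∂Q, ∀ k, 0 ≤ w k z ∧ w k z ≤ 1)
    {m η c : ℝ} (hm : ∀ k, ∫ z, w k z ∂Q ≤ m) (hm0 : 0 ≤ m) (h0 : 0 ≤ η) (h1 : η ≤ 1) (n : ℕ) :
    Integrable (fun z : Fin n → Z =>
        (∑ i, r (z i)) * (1 - ∑ k, Real.exp (η * (∑ j, w k (z j) - c))))
      (Measure.pi fun _ => Q) ∧
    n * (∫ z, r z ∂Q) * (1 - Fintype.card K * Real.exp (η + (η + η ^ 2) * (n * m) - η * c)) ≤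
      ∫ z : Fin n → Z, (∑ i, r (z i)) * (1 - ∑ k, Real.exp (η * (∑ j, w k (z j) - c)))
        ∂(Measure.pi fun _ => Q) := by
  classical
  set ρ := ∫ z, r z ∂Q
  have hρ : 0 ≤ ρ := integral_nonneg_of_ae hr0
  set E : K → Z → ℝ := fun k z => Real.exp (η * w k z)
  have hEm : ∀ k, Measurable (E k) := fun k => by have := hw k; fun_prop
  have hE1 : ∀ᵐ z ∂Q, ∀ k, ‖E k z‖ ≤ Real.exp η := by
    filter_upwards [hw01] with z hz k
    rw [Real.norm_of_nonneg (Real.exp_pos _).le]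
    exact Real.exp_le_exp.2 (mul_le_of_le_one_right h0 (hz k).2)
  have hEi : ∀ k, Integrable (E k) Q := fun k =>
    Integrable.of_bound (hEm k).aestronglyMeasurable (Real.exp η) (hE1.mono fun z hz => hz k)
  have hrE : ∀ k, Integrable (fun z => r z * E k z) Q := fun k =>
    hr.mul_bdd (c := Real.exp η) (hEm k).aestronglyMeasurable (hE1.mono fun z hz => hz k)
  -- An item's reward and consumption are dependent and the reward may be unbounded, so an overflow
  -- probability alone would not suffice. The product `r (z i) * ∏ j, E k (z j)` still factorizes
  -- over items, and the dependence inside item `i` costs only a factor `exp η`.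
  set g : K → Fin n → Fin n → Z → ℝ := fun k i j z => if j = i then r z * E k z else E k z
  have hgi : ∀ k i j, Integrable (g k i j) Q := fun k i j => by
    by_cases h : j = i
    · simpa [g, h] using hrE k
    · simpa [g, h] using hEi k
  have hprod : ∀ k i (z : Fin n → Z), ∏ j, g k i j (z j) = r (z i) * ∏ j, E k (z j) := by
    intro k i z
    rw [← Finset.mul_prod_erase _ _ (Finset.mem_univ i),
      ← Finset.mul_prod_erase _ (fun j => E k (z j)) (Finset.mem_univ i)]
    rw [Finset.prod_congr rfl (g := fun j => E k (z j)) fun j hj => by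
      simp [g, Finset.ne_of_mem_erase hj]]
    simp [g, mul_assoc]
  have hpi : ∀ k i, Integrable (fun z : Fin n → Z => r (z i) * ∏ j, E k (z j))
      (Measure.pi fun _ => Q) := fun k i => by
    have := Integrable.fintype_prod (μ := fun _ : Fin n => Q) (f := g k i) (hgi k i)
    simpa only [hprod] using this
  have hbound : ∀ k (i : Fin n), ∫ z : Fin n → Z, r (z i) * ∏ j, E k (z j)
      ∂(Measure.pi fun _ => Q) ≤ ρ * Real.exp (η + (η + η ^ 2) * (n * m)) := by
    intro k i
    simp only [← hprod]
    rw [integral_fintype_prod_eq_prod (μ := fun _ : Fin n => Q) (f := g k i),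
      ← Finset.mul_prod_erase _ _ (Finset.mem_univ i)]
    have h2 : ∫ z, g k i i z ∂Q ≤ ρ * Real.exp η := by
      simp only [g, if_true]
      rw [← integral_mul_const]
      refine integral_mono_ae (hrE k) (hr.mul_const _) ?_
      filter_upwards [hr0, hE1] with z hz hz'
      exact mul_le_mul_of_nonneg_left ((le_abs_self _).trans (hz' k)) hz
    have h3 : ∏ j ∈ Finset.univ.erase i, ∫ z, g k i j z ∂Q ≤
        ∏ j ∈ Finset.univ.erase i, Real.exp ((η + η ^ 2) * m) := by
      refine Finset.prod_le_prod (fun j hj => ?_) fun j hj => ?_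
      · simp only [g, Finset.ne_of_mem_erase hj, if_false]
        exact integral_nonneg fun z => (Real.exp_pos _).le
      · simp only [g, Finset.ne_of_mem_erase hj, if_false]
        exact integral_exp_mul_le (hw k).aestronglyMeasurable (hw01.mono fun z hz => hz k)
          h0 h1 (hm k)
    have h4 : ∏ j ∈ Finset.univ.erase i, Real.exp ((η + η ^ 2) * m) ≤
        Real.exp ((η + η ^ 2) * (n * m)) := by
      rw [Finset.prod_const, ← Real.exp_nat_mul, Finset.card_erase_of_mem (Finset.mem_univ i),
        Finset.card_univ, Fintype.card_fin]
      refine Real.exp_le_exp.2 ?_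
      have : ((n - 1 : ℕ) : ℝ) ≤ n := by exact_mod_cast Nat.sub_le n 1
      calc ((n - 1 : ℕ) : ℝ) * ((η + η ^ 2) * m) ≤ n * ((η + η ^ 2) * m) := by gcongr
        _ = _ := by ring
    have h5 : 0 ≤ ∏ j ∈ Finset.univ.erase i, ∫ z, g k i j z ∂Q := by
      refine Finset.prod_nonneg fun j hj => ?_
      simp only [g, Finset.ne_of_mem_erase hj, if_false]
      exact integral_nonneg fun z => (Real.exp_pos _).le
    calc _ ≤ (ρ * Real.exp η) * Real.exp ((η + η ^ 2) * (n * m)) :=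
          mul_le_mul h2 (h3.trans h4) h5 (by positivity)
      _ = _ := by rw [mul_assoc, ← Real.exp_add]
  have hri : ∀ i : Fin n, Integrable (fun z : Fin n → Z => r (z i)) (Measure.pi fun _ => Q) :=
    fun i => ((measurePreserving_eval (fun _ : Fin n => Q) i).integrable_comp
      hr.aestronglyMeasurable).2 hr
  have hexpand : (fun z : Fin n → Z =>
      (∑ i, r (z i)) * (1 - ∑ k, Real.exp (η * (∑ j, w k (z j) - c)))) = fun z =>
      ∑ i, r (z i) - ∑ i, ∑ k, Real.exp (-(η * c)) * (r (z i) * ∏ j, E k (z j)) := by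
    funext z
    have : ∀ k, Real.exp (η * (∑ j, w k (z j) - c)) =
        Real.exp (-(η * c)) * ∏ j, E k (z j) := fun k => by
      rw [← Real.exp_sum, ← Real.exp_add, ← Finset.mul_sum]
      congr 1; ring
    simp only [this]
    rw [mul_sub, mul_one, Finset.sum_mul_sum]
    congr 1
    exact Finset.sum_congr rfl fun i _ => Finset.sum_congr rfl fun k _ => by ring
  have hI1 : Integrable (fun z : Fin n → Z => ∑ i, r (z i)) (Measure.pi fun _ => Q) :=
    integrable_finsetSum _ fun i _ => hri i
  have hI3 : ∀ i : Fin n, Integrable (fun z : Fin n → Z =>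
      ∑ k, Real.exp (-(η * c)) * (r (z i) * ∏ j, E k (z j))) (Measure.pi fun _ => Q) :=
    fun i => integrable_finsetSum _ fun k _ => (hpi k i).const_mul _
  have hI2 : Integrable (fun z : Fin n → Z =>
      ∑ i, ∑ k, Real.exp (-(η * c)) * (r (z i) * ∏ j, E k (z j))) (Measure.pi fun _ => Q) :=
    integrable_finsetSum _ fun i _ => hI3 i
  rw [hexpand]
  refine ⟨hI1.sub hI2, ?_⟩
  rw [integral_sub hI1 hI2, integral_finsetSum _ fun i _ => hri i,
    integral_finsetSum _ fun i _ => hI3 i]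
  have h6 : ∀ i : Fin n, ∫ z : Fin n → Z, r (z i) ∂(Measure.pi fun _ => Q) = ρ := fun i => by
    have he := measurePreserving_eval (fun _ : Fin n => Q) i
    have := integral_map (μ := Measure.pi fun _ : Fin n => Q) he.measurable.aemeasurable
      (f := r) (by rw [he.map_eq]; exact hr.aestronglyMeasurable)
    rw [he.map_eq] at this
    exact this.symm
  have h7 : ∀ i : Fin n, ∫ z : Fin n → Z,
      ∑ k, Real.exp (-(η * c)) * (r (z i) * ∏ j, E k (z j)) ∂(Measure.pi fun _ => Q) ≤
      ρ * (Fintype.card K * Real.exp (η + (η + η ^ 2) * (n * m) - η * c)) := fun i => by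
    rw [integral_finsetSum _ fun k _ => (hpi k i).const_mul _]
    calc _ ≤ ∑ k : K, ρ * Real.exp (η + (η + η ^ 2) * (n * m) - η * c) := by
          refine Finset.sum_le_sum fun k _ => ?_
          rw [integral_const_mul, sub_eq_add_neg, Real.exp_add _ (-(η * c))]
          have := mul_le_mul_of_nonneg_left (hbound k i) (Real.exp_pos (-(η * c))).le
          linarith
      _ = _ := by simp; ring
  simp only [h6]
  have h8 := Finset.sum_le_sum fun (i : Fin n) (_ : i ∈ Finset.univ) => h7 i
  simp only [Finset.sum_const, Finset.card_univ, Fintype.card_fin, nsmul_eq_mul] at h8 ⊢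
  linarith

section Offline

variable {J K S : Type*} [Fintype J] [MeasurableSpace S]
  {D : Measure (Item J K)} [IsProbabilityMeasure D] {ν : Measure S} [IsProbabilityMeasure ν]

/-- The optimal value is the sum of the item rewards, which all have the same mean. -/
theorem Solver.IsEquivariant.integral_offlineOpt {σ : Solver J K S} (hσ : σ.IsEquivariant ν)
    {s₀ : S} {b : K → ℝ} (hA : ∀ᵐ ξ ∂D, ∀ j k, 0 ≤ ξ.2 j k) (hb : 0 ≤ b) {T : ℕ}
    (hs : Integrable (σ.singleOpt s₀ b) D)
    (hOPT : Integrable (fun ξ : Fin T → Item J K => offlineOpt b ξ)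
      (Measure.pi fun _ : Fin T => D)) (i : Fin T) :
    ∫ ξ : Fin T → Item J K, offlineOpt b ξ ∂(Measure.pi fun _ : Fin T => D) =
      T * ∫ p : (Fin T → Item J K) × S, itemReward (p.1 i) (σ.solve p.2 T p.1 b i)
        ∂((Measure.pi fun _ => D).prod ν) := by
  have h := hσ.integral_sum (D := D) hb i measurable_itemReward
    (σ.integrable_itemReward hA hb le_rfl hs i)
  simp only at h
  rw [← h]
  have hf := measurePreserving_fst (μ := Measure.pi fun _ : Fin T => D) (ν := ν)
  have := integral_map hf.measurable.aemeasurable (f := fun ξ => offlineOpt b ξ)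
    (by rw [hf.map_eq]; exact hOPT.aestronglyMeasurable)
  rw [hf.map_eq] at this
  rw [this]
  exact integral_congr_ae (.of_forall fun p => (σ.isOptimal_solve hb p.2 p.1).offlineOpt_eq)

/-- A randomized rule for a single item: play as in a `T`-item instance with probability `1 - γ`,
and reject the item with probability `γ`. -/
theorem Solver.IsEquivariant.exists_thinned_law {σ : Solver J K S} (hσ : σ.IsEquivariant ν)
    {s₀ : S} {b : K → ℝ} (hA : ∀ᵐ ξ ∂D, ∀ j k, 0 ≤ ξ.2 j k) (hb : 0 ≤ b) {T : ℕ} (hT : 0 < T)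
    (hs : Integrable (σ.singleOpt s₀ b) D)
    (hOPT : Integrable (fun ξ : Fin T → Item J K => offlineOpt b ξ)
      (Measure.pi fun _ : Fin T => D)) {γ : ℝ} (hγ0 : 0 ≤ γ) (hγ1 : γ ≤ 1) :
    ∃ Q : Measure (Item J K × (J → ℝ)), IsProbabilityMeasure Q ∧
      MeasurePreserving Prod.fst Q D ∧ (∀ᵐ z ∂Q, z.2 ∈ Actions J) ∧
      Integrable (fun z => itemReward z.1 z.2) Q ∧ (∀ᵐ z ∂Q, 0 ≤ itemReward z.1 z.2) ∧
      ∫ z, itemReward z.1 z.2 ∂Q =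
        (1 - γ) * ((∫ ξ : Fin T → Item J K, offlineOpt b ξ ∂(Measure.pi fun _ => D)) / T) ∧
      ∀ k, ∫ z, itemUse z.1 z.2 k ∂Q ≤ (1 - γ) * (b k / T) := by
  set i : Fin T := ⟨0, hT⟩
  set φ : (Fin T → Item J K) × S → Item J K × (J → ℝ) :=
    fun p => (p.1 i, σ.solve p.2 T p.1 b i)
  have hφ : Measurable φ := ((measurable_pi_apply i).comp
    measurable_fst).prodMk (σ.measurable_comp measurable_snd measurable_fst measurable_const i)
  set P := (Measure.pi fun _ : Fin T => D).prod ν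
  set Q₀ := P.map φ
  have hQ₀ : IsProbabilityMeasure Q₀ := Measure.isProbabilityMeasure_map hφ.aemeasurable
  set ψ : Item J K × (J → ℝ) → Item J K × (J → ℝ) := fun z => (z.1, 0)
  have hψ : Measurable ψ := by fun_prop
  set Q₁ := Q₀.map ψ
  have hQ₁ : IsProbabilityMeasure Q₁ := Measure.isProbabilityMeasure_map hψ.aemeasurable
  have hT0 : (T : ℝ) ≠ 0 := by positivity
  have hae := ae_prod_fst (ν := ν) (ae_pi_of_ae (ι := Fin T) hA)
  have hfst : Q₀.map Prod.fst = D := by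
    rw [Measure.map_map measurable_fst hφ]
    exact ((measurePreserving_eval (fun _ : Fin T => D) i).comp measurePreserving_fst).map_eq
  have hfst1 : Q₁.map Prod.fst = D := by
    rw [Measure.map_map measurable_fst hψ]
    exact hfst
  set Q := ENNReal.ofReal (1 - γ) • Q₀ + ENNReal.ofReal γ • Q₁
  have hae_of : ∀ p : Item J K × (J → ℝ) → Prop, MeasurableSet {z | p z} →
      (∀ᵐ z ∂P, p (φ z)) → (∀ z, p (z, 0)) → ∀ᵐ z ∂Q, p z := by
    intro p hp h h0
    rw [ae_add_measure_iff]
    exact ⟨Measure.ae_smul_measure ((ae_map_iff hφ.aemeasurable hp).2 h) _,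
      Measure.ae_smul_measure ((ae_map_iff hψ.aemeasurable hp).2 (.of_forall fun z => h0 _)) _⟩
  have hint_of : ∀ f : Item J K × (J → ℝ) → ℝ, Measurable f → Integrable (fun z => f (φ z)) P →
      (∀ z, f (z, 0) = 0) → Integrable f Q ∧ ∫ z, f z ∂Q = (1 - γ) * ∫ z, f (φ z) ∂P := by
    intro f hf hi h0
    have hi0 : Integrable f Q₀ :=
      (integrable_map_measure hf.aestronglyMeasurable hφ.aemeasurable).2 hi
    have hi1 : Integrable f Q₁ :=
      (integrable_map_measure hf.aestronglyMeasurable hψ.aemeasurable).2 (by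
        simp [ψ, Function.comp_def, h0])
    have hi0' := hi0.smul_measure (c := ENNReal.ofReal (1 - γ)) ENNReal.ofReal_ne_top
    have hi1' := hi1.smul_measure (c := ENNReal.ofReal γ) ENNReal.ofReal_ne_top
    refine ⟨hi0'.add_measure hi1', ?_⟩
    rw [integral_add_measure hi0' hi1', integral_smul_measure, integral_smul_measure,
      integral_map hφ.aemeasurable hf.aestronglyMeasurable,
      integral_map hψ.aemeasurable hf.aestronglyMeasurable]
    simp [ψ, h0, ENNReal.toReal_ofReal (sub_nonneg.2 hγ1)]
  have hact : MeasurableSet {z : Item J K × (J → ℝ) | z.2 ∈ Actions J} := by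
    have h1 : MeasurableSet {x : J → ℝ | x ∈ Actions J} := by
      have : {x : J → ℝ | x ∈ Actions J} =
          (⋂ j, ({x | x j = 0} ∪ {x | x j = 1})) ∩ {x | ∑ j, x j ≤ 1} := by
        ext x; simp [Actions]
      rw [this]
      refine (MeasurableSet.iInter fun j => ?_).inter
        (measurableSet_le (by fun_prop) measurable_const)
      exact (measurableSet_eq_fun (measurable_pi_apply j) measurable_const).union
        (measurableSet_eq_fun (measurable_pi_apply j) measurable_const)
    exact measurable_snd h1
  have hr := hint_of (fun z => itemReward z.1 z.2) measurable_itemReward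
    (σ.integrable_itemReward hA hb le_rfl hs i) (by simp)
  refine ⟨Q, ⟨?_⟩, ⟨measurable_fst, ?_⟩, hae_of _ hact ?_ fun _ => zero_mem_actions, hr.1,
    hae_of _ (measurableSet_le measurable_const measurable_itemReward) ?_ (by simp),
    ?_, fun k => ?_⟩
  · simp only [Q, Measure.add_apply, Measure.smul_apply, measure_univ, smul_eq_mul, mul_one]
    rw [← ENNReal.ofReal_add (sub_nonneg.2 hγ1) hγ0]
    simp
  · rw [Measure.map_add _ _ measurable_fst, Measure.map_smul, Measure.map_smul, hfst, hfst1,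
      ← add_smul, ← ENNReal.ofReal_add (sub_nonneg.2 hγ1) hγ0]
    simp
  · exact .of_forall fun p => (σ.isOptimal_solve hb p.2 p.1).1.1 i
  · filter_upwards [hae] with p hp
    exact (σ.isOptimal_solve hb p.2 p.1).itemReward_nonneg hp i
  · rw [hr.2, hσ.integral_offlineOpt hA hb hs hOPT i, mul_div_cancel_left₀ _ hT0]
  · have hm : Measurable (fun p : Item J K × (J → ℝ) => itemUse p.1 p.2 k) :=
      (measurable_pi_apply k).comp measurable_itemUse
    have hu := hint_of (fun z => itemUse z.1 z.2 k) hm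
      (Integrable.of_bound (hm.comp hφ).aestronglyMeasurable (b k) (by
        filter_upwards [hae] with p hp
        have ho := (σ.isOptimal_solve hb p.2 p.1).1
        rw [Real.norm_of_nonneg (itemUse_nonneg (hp i) (ho.1 i) k)]
        exact ho.itemUse_le hp i k)) (by simp)
    rw [hu.2]
    exact mul_le_mul_of_nonneg_left (hσ.integral_itemUse_le hA hb i k) (sub_nonneg.2 hγ1)

/-- Lower bound on the value of an `n`-item instance with capacities close to `n / T` times
the original ones. -/
theorem Solver.IsEquivariant.le_integral_itemReward [Fintype K] {σ : Solver J K S}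
    (hσ : σ.IsEquivariant ν) {s₀ : S} {b : K → ℝ} (hA : ∀ᵐ ξ ∂D, ∀ j k, 0 ≤ ξ.2 j k)
    (hb : 0 ≤ b) {T : ℕ} (hT : 0 < T) (hs : Integrable (σ.singleOpt s₀ b) D)
    (hOPT : Integrable (fun ξ : Fin T → Item J K => offlineOpt b ξ)
      (Measure.pi fun _ : Fin T => D)) {R : ℝ} (hR0 : 0 ≤ R)
    (hR : ∀ᵐ ξ ∂D, ∀ j k, R * ξ.2 j k ≤ b k) {γ : ℝ} (hγ0 : 0 ≤ γ) (hγ1 : γ ≤ 1) {n : ℕ}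
    (i : Fin n) {B : K → ℝ} (hB0 : 0 ≤ B) (hBb : B ≤ b)
    (hB : ∀ k, (1 - γ / 4) * (n / T) * b k ≤ B k) {Λ δ : ℝ} (hΛ : 1 ≤ Λ)
    (hγΛ : 16 * Λ ≤ n * R / T * γ ^ 2) (hδ : Fintype.card K * Real.exp (-Λ) ≤ δ) :
    (1 - γ) * (1 - δ) *
        ((∫ ξ : Fin T → Item J K, offlineOpt b ξ ∂(Measure.pi fun _ => D)) / T) ≤
      ∫ p : (Fin n → Item J K) × S, itemReward (p.1 i) (σ.solve p.2 n p.1 B i)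
        ∂((Measure.pi fun _ => D).prod ν) := by
  obtain ⟨Q, hQ, hfst, hact, hri, hr0, hrV, hu⟩ :=
    hσ.exists_thinned_law hA hb hT hs hOPT hγ0 hγ1
  set V := (∫ ξ : Fin T → Item J K, offlineOpt b ξ ∂(Measure.pi fun _ => D)) / (T : ℝ)
  have hT0 : (0 : ℝ) < T := by exact_mod_cast hT
  have hn0 : (0 : ℝ) < n := by exact_mod_cast i.pos
  -- Consumption rescaled to `[0, 1]`: one action uses at most `b k / R`.
  set w : K → Item J K × (J → ℝ) → ℝ := fun k z => R / b k * itemUse z.1 z.2 k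
  have hw : ∀ k, Measurable (w k) := fun k =>
    ((measurable_pi_apply k).comp measurable_itemUse).const_mul _
  have hA' := hfst.quasiMeasurePreserving.ae hA
  have hR' := hfst.quasiMeasurePreserving.ae hR
  have hw01 : ∀ᵐ z ∂Q, ∀ k, 0 ≤ w k z ∧ w k z ≤ 1 := by
    filter_upwards [hA', hR', hact] with z hz hz' hx k
    refine ⟨mul_nonneg (div_nonneg hR0 (hb k)) (itemUse_nonneg hz hx k), ?_⟩
    rcases (hb k).eq_or_lt with h | h
    · simp only [w]; rw [← h]; simp
    · rcases hR0.eq_or_lt with h' | h'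
      · simp [w, ← h']
      · have := OnlineAllocation.itemUse_le hx (k := k) (c := b k / R) (div_nonneg (hb k) hR0)
          fun j => by rw [le_div_iff₀ h', mul_comm]; exact hz' j k
        calc w k z ≤ R / b k * (b k / R) :=
              mul_le_mul_of_nonneg_left this (div_nonneg hR0 (hb k))
          _ = 1 := by
              have : b k ≠ 0 := h.ne'
              field_simp
  have hm : ∀ k, ∫ z, w k z ∂Q ≤ (1 - γ) * (R / T) := fun k => by
    simp only [w]
    rw [integral_const_mul]
    calc _ ≤ R / b k * ((1 - γ) * (b k / T)) :=
          mul_le_mul_of_nonneg_left (hu k) (div_nonneg hR0 (hb k))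
      _ = (1 - γ) * (R / T) * (b k / b k) := by ring
      _ ≤ (1 - γ) * (R / T) * 1 := by
          have := sub_nonneg.2 hγ1
          gcongr
          exact div_self_le_one _
      _ = _ := mul_one _
  have hRpos : 0 < R := hR0.lt_of_ne fun h => by
    simp only [← h, mul_zero, zero_div, zero_mul] at hγΛ
    linarith
  set N := (n : ℝ) * R / T
  have hN0 : 0 ≤ N := by positivity
  have hm0 : 0 ≤ (1 - γ) * (R / T) := mul_nonneg (sub_nonneg.2 hγ1) (by positivity)
  obtain ⟨hGi, hG⟩ := integral_iid_penalized hri hr0 hw hw01 (c := (1 - γ / 4) * N) hm hm0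
    (η := γ / 4) (by positivity) (by linarith) n
  set G : (Fin n → Item J K × (J → ℝ)) → ℝ := fun z => (∑ i, itemReward (z i).1 (z i).2) *
    (1 - ∑ k, Real.exp (γ / 4 * (∑ j, w k (z j) - (1 - γ / 4) * N)))
  have hV0 : 0 ≤ (1 - γ) * V := by
    rw [← hrV]; exact integral_nonneg_of_ae hr0
  -- With `η = γ / 4`, load `(1 - γ) N` and threshold `(1 - γ / 4) N`, the exponent is `γ / 4 - N γ²
  -- / 8 - N γ³ / 16`. As `N γ² ≥ 16 Λ` and `Λ ≥ 1`, it is at most `1 / 4 - 2 Λ ≤ -Λ`.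
  have hexp : Fintype.card K * Real.exp (γ / 4 + (γ / 4 + (γ / 4) ^ 2) *
      (n * ((1 - γ) * (R / T))) - γ / 4 * ((1 - γ / 4) * N)) ≤ δ := by
    refine le_trans (mul_le_mul_of_nonneg_left (Real.exp_le_exp.2 ?_) (by positivity)) hδ
    have : (n : ℝ) * ((1 - γ) * (R / T)) = (1 - γ) * N := by simp only [N]; ring
    rw [this]
    have h3 : 0 ≤ N * γ ^ 3 := by positivity
    nlinarith
  have hlow : n * ((1 - γ) * (1 - δ) * V) ≤ ∫ z, G z ∂(Measure.pi fun _ => Q) := by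
    refine le_trans ?_ hG
    rw [hrV]
    have h1 : 0 ≤ n * ((1 - γ) * V) := by positivity
    nlinarith [mul_le_mul_of_nonneg_left hexp h1]
  -- If the thinned plays fit into `B`, the optimum beats their reward, hence also `G`. Otherwise
  -- the term of an overflowing resource is at least 1, so `G ≤ 0`.
  have hfeas : ∀ᵐ z ∂(Measure.pi fun _ : Fin n => Q), ∀ s,
      G z ≤ ∑ t, itemReward (z t).1 (σ.solve s n (fun t => (z t).1) B t) := by
    filter_upwards [ae_pi_of_ae (ι := Fin n) hA', ae_pi_of_ae (ι := Fin n) hR',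
      ae_pi_of_ae (ι := Fin n) hact, ae_pi_of_ae (ι := Fin n) hr0] with z hz hz' hx hr s
    have ho := σ.isOptimal_solve hB0 s (fun t => (z t).1)
    have hr' : 0 ≤ ∑ i, itemReward (z i).1 (z i).2 := Finset.sum_nonneg fun t _ => hr t
    by_cases hf : Feasible (fun t => (z t).1) B (fun t => (z t).2)
    · refine le_trans (mul_le_of_le_one_right hr' ?_) (ho.2 _ hf)
      have : 0 ≤ ∑ k, Real.exp (γ / 4 * (∑ j, w k (z j) - (1 - γ / 4) * N)) :=
        Finset.sum_nonneg fun k _ => (Real.exp_pos _).le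
      linarith
    · refine le_trans ?_ (Finset.sum_nonneg fun t _ => ho.itemReward_nonneg hz t)
      refine mul_nonpos_of_nonneg_of_nonpos hr' ?_
      have : ∃ k, B k < ∑ t, itemUse (z t).1 (z t).2 k := by
        by_contra! h
        exact hf ⟨hx, h⟩
      obtain ⟨k, hk⟩ := this
      -- A resource of zero capacity cannot overflow: `R > 0` forces all its consumptions to be
      -- non-positive.
      have hbk : 0 < b k := by
        refine (hb k).lt_of_ne fun h => hk.not_ge (le_trans (Finset.sum_nonpos fun t _ =>
          OnlineAllocation.itemUse_le (hx t) le_rfl fun j => ?_) (hB0 k))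
        have := hz' t j k
        rw [← h] at this
        exact nonpos_of_mul_nonpos_right this hRpos
      have h1 : (1 - γ / 4) * N ≤ ∑ j, w k (z j) := by
        simp only [w, ← Finset.mul_sum]
        calc (1 - γ / 4) * N = R / b k * ((1 - γ / 4) * (n / T) * b k) := by
              have : b k ≠ 0 := hbk.ne'
              simp only [N]; field_simp
          _ ≤ _ := mul_le_mul_of_nonneg_left ((hB k).trans hk.le) (div_nonneg hR0 (hb k))
      have h2 : 1 ≤ Real.exp (γ / 4 * (∑ j, w k (z j) - (1 - γ / 4) * N)) :=
        Real.one_le_exp (mul_nonneg (by positivity) (sub_nonneg.2 h1))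
      have h3 := h2.trans (Finset.single_le_sum
        (f := fun k => Real.exp (γ / 4 * (∑ j, w k (z j) - (1 - γ / 4) * N)))
        (fun k _ => (Real.exp_pos _).le) (Finset.mem_univ k))
      linarith
  have hri' := fun t => σ.integrable_itemReward (ν := ν) hA hB0 hBb hs (n := n) t
  have hsum := hσ.integral_sum hB0 i measurable_itemReward (hri' i)
  simp only at hsum
  have hproj : MeasurePreserving
      (fun p : (Fin n → Item J K × (J → ℝ)) × S => ((fun t => (p.1 t).1 : Fin n → Item J K), p.2))
      ((Measure.pi fun _ => Q).prod ν) ((Measure.pi fun _ => D).prod ν) :=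
    (measurePreserving_pi _ _ fun _ => hfst).prod (MeasurePreserving.id ν)
  have hFi : Integrable (fun p : (Fin n → Item J K) × S =>
      ∑ t, itemReward (p.1 t) (σ.solve p.2 n p.1 B t)) ((Measure.pi fun _ => D).prod ν) :=
    integrable_finsetSum _ fun t _ => hri' t
  have hFm : ∫ p : (Fin n → Item J K) × S,
      ∑ t, itemReward (p.1 t) (σ.solve p.2 n p.1 B t) ∂((Measure.pi fun _ => D).prod ν) =
      ∫ p : (Fin n → Item J K × (J → ℝ)) × S,
        ∑ t, itemReward (p.1 t).1 (σ.solve p.2 n (fun t => (p.1 t).1) B t)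
        ∂((Measure.pi fun _ => Q).prod ν) := by
    have := integral_map hproj.measurable.aemeasurable
      (f := fun p : (Fin n → Item J K) × S =>
        ∑ t, itemReward (p.1 t) (σ.solve p.2 n p.1 B t))
      (by rw [hproj.map_eq]; exact hFi.aestronglyMeasurable)
    rw [hproj.map_eq] at this
    exact this
  have hGF : ∫ z, G z ∂(Measure.pi fun _ => Q) ≤
      ∫ p : (Fin n → Item J K) × S,
        ∑ t, itemReward (p.1 t) (σ.solve p.2 n p.1 B t) ∂((Measure.pi fun _ => D).prod ν) := by
    rw [hFm]
    have h1 : ∫ p : (Fin n → Item J K × (J → ℝ)) × S, G p.1 ∂((Measure.pi fun _ => Q).prod ν) =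
        ∫ z, G z ∂(Measure.pi fun _ => Q) := by
      rw [integral_fun_fst]; simp
    rw [← h1]
    refine integral_mono_ae (hGi.comp_fst ν)
      ((hproj.integrable_comp hFi.aestronglyMeasurable).2 hFi) ?_
    filter_upwards [ae_prod_fst (ν := ν) hfeas] with p hp using hp p.2
  have := hlow.trans (hGF.trans_eq hsum)
  exact le_of_mul_le_mul_left this hn0

end Offline

/-! ### Redrawing the randomness of one period. -/

section Scenarios

variable {J K S : Type*} {T : ℕ}

theorem stageItems_zero (ω : Scenario J K S T) (t : Fin T) :
    stageItems ω t ⟨0, by omega⟩ = ω.1 t := by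
  simp [stageItems]

theorem stageItems_nonneg {ω : Scenario J K S T} (h : (∀ t j k, 0 ≤ (ω.1 t).2 j k) ∧
    ∀ t s j k, 0 ≤ (ω.2.1 t s).2 j k) (t : Fin T) (i : Fin (T - t)) (j : J) (k : K) :
    0 ≤ (stageItems ω t i).2 j k := by
  unfold stageItems
  split_ifs
  · exact h.1 t j k
  · exact h.2 _ _ j k

variable [MeasurableSpace S]

theorem measurable_stageItems (t : Fin T) :
    Measurable fun ω : Scenario J K S T => stageItems ω t := by
  refine measurable_pi_lambda _ fun i => ?_
  unfold stageItems
  by_cases h : i.val = 0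
  · simp only [h, if_true]; fun_prop
  · simp only [h, if_false]; fun_prop

/-- Replace all the randomness of period `t`. -/
def resample (t : Fin T) (p : Scenario J K S T × (Item J K × (Fin T → Item J K) × S)) :
    Scenario J K S T :=
  (Function.update p.1.1 t p.2.1, Function.update p.1.2.1 t p.2.2.1,
    Function.update p.1.2.2 t p.2.2.2)

variable {D : Measure (Item J K)} [IsProbabilityMeasure D] {ν : Measure S}
  [IsProbabilityMeasure ν]

instance : IsProbabilityMeasure (scenarioLaw D ν T) := by
  unfold scenarioLaw; infer_instance

theorem measurePreserving_resample (t : Fin T) :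
    MeasurePreserving (resample (J := J) (K := K) (S := S) t)
      ((scenarioLaw D ν T).prod (D.prod ((Measure.pi fun _ : Fin T => D).prod ν)))
      (scenarioLaw D ν T) := by
  have h1 := measurePreserving_update D t
  have h2 := measurePreserving_update (Measure.pi fun _ : Fin T => D) t
  have h3 := measurePreserving_update ν t
  have h23 := (h2.prod h3).comp (measurePreserving_prodProdProdComm
    (Measure.pi fun _ : Fin T => Measure.pi fun _ : Fin T => D) (Measure.pi fun _ : Fin T => ν)
    (Measure.pi fun _ : Fin T => D) ν)
  exact (h1.prod h23).comp (measurePreserving_prodProdProdComm _ _ _ _)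

/-- Overwriting coordinate `t` of the sample path by the arrived item leaves an i.i.d. path; the
instance is its restriction to the coordinates `t + i`. -/
theorem measurePreserving_stage (t : Fin T) :
    MeasurePreserving (fun x : Item J K × (Fin T → Item J K) × S =>
        ((fun i => if i.val = 0 then x.1 else x.2.1 ⟨t + i, by omega⟩ : Fin (T - t) → Item J K),
          x.2.2))
      (D.prod ((Measure.pi fun _ : Fin T => D).prod ν))
      ((Measure.pi fun _ => D).prod ν) := by
  have hf : Function.Injective (fun i : Fin (T - t) => (⟨t + i, by omega⟩ : Fin T)) := by
    intro i j h
    simp only [Fin.mk.injEq] at h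
    exact Fin.ext (by omega)
  have h1 := (measurePreserving_reindex D hf).comp
    ((measurePreserving_update D t).comp
      (Measure.measurePreserving_swap (μ := D) (ν := Measure.pi fun _ : Fin T => D)))
  have h2 := (h1.prod (MeasurePreserving.id ν)).comp
    ((measurePreserving_prodAssoc D (Measure.pi fun _ : Fin T => D) ν).symm)
  convert h2 using 1
  funext x
  refine Prod.ext (funext fun i => ?_) rfl
  by_cases hi : i.val = 0
  · have : (⟨t + i, by omega⟩ : Fin T) = t := Fin.ext (by simp [hi])
    simp [hi, MeasurableEquiv.prodAssoc]
  · have : (⟨t + i, by omega⟩ : Fin T) ≠ t := fun h => hi (by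
      have := congrArg Fin.val h
      simpa using this)
    simp [hi, MeasurableEquiv.prodAssoc, Function.update_of_ne this]

theorem ae_nonneg_scenario (hA : ∀ᵐ ξ ∂D, ∀ j k, 0 ≤ ξ.2 j k) :
    ∀ᵐ ω ∂(scenarioLaw D ν T), (∀ t j k, 0 ≤ (ω.1 t).2 j k) ∧
      ∀ t s j k, 0 ≤ (ω.2.1 t s).2 j k := by
  have h1 := ae_prod_fst (ν := (Measure.pi fun _ : Fin T => Measure.pi fun _ : Fin T => D).prod
    (Measure.pi fun _ : Fin T => ν)) (ae_pi_of_ae (ι := Fin T) hA)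
  have h2 := (Measure.quasiMeasurePreserving_snd (μ := Measure.pi fun _ : Fin T => D)).ae
    (ae_prod_fst (ν := Measure.pi fun _ : Fin T => ν)
      (ae_pi_of_ae (ι := Fin T) (ae_pi_of_ae (ι := Fin T) hA)))
  filter_upwards [h1, h2] with ω h h' using ⟨h, h'⟩

end Scenarios

/-! ### Independence of the past and feasibility along a run. -/

section OnlineLemmas

variable {J K S : Type*} [Fintype J] [MeasurableSpace S] {T : ℕ}

theorem measurable_osoUsed (σ : Solver J K S) (b : K → ℝ) (t : ℕ) :
    Measurable fun ω : Scenario J K S T => osoUsed σ b ω t := by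
  induction t with
  | zero => exact measurable_const
  | succ t ih =>
    by_cases h : t < T
    · simp only [osoUsed, h, dif_pos]
      refine ih.add (measurable_itemUse.comp (Measurable.prodMk (by fun_prop) ?_))
      exact σ.measurable_comp (by fun_prop) (measurable_stageItems _) (measurable_const.sub ih) _
    · simpa only [osoUsed, h, dif_neg, not_false_eq_true] using ih

theorem osoUsed_succ (σ : Solver J K S) (b : K → ℝ) (ω : Scenario J K S T) (t : Fin T) :
    osoUsed σ b ω (t + 1) = osoUsed σ b ω t + itemUse (ω.1 t) (osoAction σ b ω t) := by
  simp [osoUsed, osoAction]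

/-- Non-anticipation: the recursion up to `t` reads only arrivals, samples and seeds of earlier
periods. -/
theorem osoUsed_congr (σ : Solver J K S) (b : K → ℝ) {ω ω' : Scenario J K S T} (t : ℕ)
    (h : ∀ s : Fin T, s.val < t → ω.1 s = ω'.1 s ∧ ω.2.1 s = ω'.2.1 s ∧ ω.2.2 s = ω'.2.2 s) :
    osoUsed σ b ω t = osoUsed σ b ω' t := by
  induction t with
  | zero => rfl
  | succ t ih =>
    have ih' := ih fun s hs => h s (by omega)
    by_cases ht : t < T
    · obtain ⟨h1, h2, h3⟩ := h ⟨t, ht⟩ (by simp)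
      have h4 : stageItems ω ⟨t, ht⟩ = stageItems ω' ⟨t, ht⟩ := by
        funext i; simp only [stageItems, h1, h2]
      simp only [osoUsed, ht, dif_pos, stageAction, ih', h1, h3, h4]
    · simp only [osoUsed, ht, dif_neg, not_false_eq_true, ih']

theorem osoUsed_resample (σ : Solver J K S) (b : K → ℝ) (t : Fin T)
    (p : Scenario J K S T × (Item J K × (Fin T → Item J K) × S)) :
    osoUsed σ b (resample t p) t = osoUsed σ b p.1 t :=
  osoUsed_congr σ b t fun s hs => by
    have : s ≠ t := fun h => by simp [h] at hs
    simp [resample, Function.update_of_ne this]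

variable {D : Measure (Item J K)} [IsProbabilityMeasure D] {ν : Measure S}
  [IsProbabilityMeasure ν]

/-- The instance solved in period `t` is an i.i.d. instance independent of the past. -/
theorem map_stage (σ : Solver J K S) (b : K → ℝ) (t : Fin T) :
    (scenarioLaw D ν T).map (fun ω => (osoUsed σ b ω t, (stageItems ω t, ω.2.2 t))) =
      ((scenarioLaw D ν T).map fun ω => osoUsed σ b ω t).prod
        ((Measure.pi fun _ => D).prod ν) := by
  have hU := measurable_osoUsed (T := T) σ b t
  have hm : Measurable fun ω : Scenario J K S T =>
      (osoUsed σ b ω t, (stageItems ω t, ω.2.2 t)) :=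
    hU.prodMk ((measurable_stageItems t).prodMk (by fun_prop))
  have hr := measurePreserving_resample (D := D) (ν := ν) (T := T) (J := J) (K := K) t
  have hs := measurePreserving_stage (D := D) (ν := ν) (T := T) (J := J) (K := K) t
  -- After period `t` is redrawn, the resources used before it are still those of the old scenario,
  -- while the stage instance depends on the fresh draw alone.
  conv_lhs => rw [← hr.map_eq]
  rw [Measure.map_map hm hr.measurable, ← hs.map_eq, Measure.map_prod_map _ _ hU hs.measurable]
  congr 1
  funext p
  refine Prod.ext (osoUsed_resample σ b t p) (Prod.ext (funext fun i => ?_) ?_)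
  · simp [stageItems, resample]
  · simp [resample]

theorem integral_stage (σ : Solver J K S) (b : K → ℝ) (t : Fin T)
    {g : (K → ℝ) × ((Fin (T - t) → Item J K) × S) → ℝ} (hg : Measurable g)
    (hint : Integrable (fun ω => g (osoUsed σ b ω t, (stageItems ω t, ω.2.2 t)))
      (scenarioLaw D ν T)) :
    Integrable (fun ω => ∫ y, g (osoUsed σ b ω t, y) ∂((Measure.pi fun _ => D).prod ν))
        (scenarioLaw D ν T) ∧
      ∫ ω, g (osoUsed σ b ω t, (stageItems ω t, ω.2.2 t)) ∂(scenarioLaw D ν T) =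
        ∫ ω, ∫ y, g (osoUsed σ b ω t, y) ∂((Measure.pi fun _ => D).prod ν)
          ∂(scenarioLaw D ν T) := by
  have hU := measurable_osoUsed (T := T) σ b t
  have hm : Measurable fun ω : Scenario J K S T =>
      (osoUsed σ b ω t, (stageItems ω t, ω.2.2 t)) :=
    hU.prodMk ((measurable_stageItems t).prodMk (by fun_prop))
  have hP := Measure.isProbabilityMeasure_map (μ := scenarioLaw D ν T) hU.aemeasurable
  have hi := (integrable_map_measure (μ := scenarioLaw D ν T) hg.aestronglyMeasurable
    hm.aemeasurable).2 hint
  rw [map_stage] at hi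
  have hi2 := hi.integral_prod_left
  have hsm := hi2.aestronglyMeasurable
  refine ⟨(integrable_map_measure hsm hU.aemeasurable).1 hi2, ?_⟩
  rw [← integral_map (μ := scenarioLaw D ν T) hm.aemeasurable hg.aestronglyMeasurable,
    map_stage, integral_prod _ hi, integral_map hU.aemeasurable hsm]

theorem itemUse_osoAction (σ : Solver J K S) {b : K → ℝ} {ω : Scenario J K S T}
    (h : (∀ t j k, 0 ≤ (ω.1 t).2 j k) ∧ ∀ t s j k, 0 ≤ (ω.2.1 t s).2 j k) (t : Fin T)
    (hu : osoUsed σ b ω t ≤ b) :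
    osoAction σ b ω t ∈ Actions J ∧ 0 ≤ itemReward (ω.1 t) (osoAction σ b ω t) ∧
      ∀ k, 0 ≤ itemUse (ω.1 t) (osoAction σ b ω t) k ∧
        itemUse (ω.1 t) (osoAction σ b ω t) k ≤ b k - osoUsed σ b ω t k := by
  have ho := σ.isOptimal_solve (sub_nonneg.2 hu) (ω.2.2 t) (stageItems ω t)
  have hn := stageItems_nonneg h t
  have h1 := ho.itemReward_nonneg hn ⟨0, by omega⟩
  have h2 := ho.1.itemUse_le hn ⟨0, by omega⟩
  rw [stageItems_zero] at h1 h2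
  exact ⟨ho.1.1 _, h1, fun k => ⟨itemUse_nonneg (h.1 t) (ho.1.1 _) k, h2 k⟩⟩

/-- Residual capacities stay non-negative because the first item's use fits alone within them, the
other items consuming non-negative amounts. Rejecting everything is then feasible in each period, so
the solver's optimality applies. -/
theorem osoUsed_mem (σ : Solver J K S) {b : K → ℝ} (hb : 0 ≤ b) {ω : Scenario J K S T}
    (h : (∀ t j k, 0 ≤ (ω.1 t).2 j k) ∧ ∀ t s j k, 0 ≤ (ω.2.1 t s).2 j k) (t : ℕ) (ht : t ≤ T) :
    0 ≤ osoUsed σ b ω t ∧ osoUsed σ b ω t ≤ b := by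
  induction t with
  | zero => exact ⟨le_rfl, hb⟩
  | succ t ih =>
    have ih' := ih (by omega)
    obtain ⟨-, -, h3⟩ := itemUse_osoAction σ h ⟨t, by omega⟩ ih'.2
    have := osoUsed_succ σ b ω ⟨t, by omega⟩
    simp only at this
    rw [this]
    refine ⟨fun k => add_nonneg (ih'.1 k) (h3 k).1, fun k => ?_⟩
    have := (h3 k).2
    simp only [Pi.add_apply]
    linarith

end OnlineLemmas

/-! ### Concentration of the remaining capacity. -/

section Concentration

variable {J K S : Type*} [Fintype J] [MeasurableSpace S] {T : ℕ}
  {D : Measure (Item J K)} [IsProbabilityMeasure D] {ν : Measure S} [IsProbabilityMeasure ν]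

/-- Fraction of the capacity of resource `k` that is left before period `t`. -/
noncomputable def remaining (σ : Solver J K S) (b : K → ℝ) (k : K) (ω : Scenario J K S T)
    (t : ℕ) : ℝ :=
  (b k - osoUsed σ b ω t k) / b k

theorem measurable_remaining (σ : Solver J K S) (b : K → ℝ) (k : K) (t : ℕ) :
    Measurable fun ω : Scenario J K S T => remaining σ b k ω t := by
  have := (measurable_pi_apply k).comp (measurable_osoUsed (T := T) σ b t)
  unfold remaining
  exact (measurable_const.sub this).div_const _

/-- One step of the exponential supermartingale. -/
theorem integral_exp_remaining_succ_le {σ : Solver J K S} (hσ : σ.IsEquivariant ν) {b : K → ℝ}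
    (hA : ∀ᵐ ξ ∂D, ∀ j k, 0 ≤ ξ.2 j k) (hb : 0 ≤ b) {R : ℝ} (hR0 : 0 < R)
    (hR : ∀ᵐ ξ ∂D, ∀ j k, R * ξ.2 j k ≤ b k) {k : K} (hk : 0 < b k) (t : Fin T) {μ μ' : ℝ}
    (h0 : 0 ≤ μ') (h1 : μ' ≤ 1) (hμ : μ ≤ μ' - (μ' + μ' ^ 2) / (T - t : ℕ)) :
    ∫ ω, Real.exp (-(R * μ' * remaining σ b k ω (t + 1))) ∂(scenarioLaw D ν T) ≤
      ∫ ω, Real.exp (-(R * μ * remaining σ b k ω t)) ∂(scenarioLaw D ν T) := by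
  have hn : 0 < T - (t : ℕ) := by omega
  set i₀ : Fin (T - t) := ⟨0, hn⟩
  set use : (K → ℝ) × ((Fin (T - t) → Item J K) × S) → ℝ := fun p =>
    R / b k * itemUse (p.2.1 i₀) (σ.solve p.2.2 (T - t) p.2.1 (b - p.1) i₀) k
  have huse : Measurable use :=
    ((measurable_pi_apply k).comp (measurable_itemUse.comp (Measurable.prodMk (by fun_prop)
      (σ.measurable_comp (by fun_prop) (by fun_prop) (by fun_prop) i₀)))).const_mul _
  -- The next exponential splits into a factor fixed by the past and `exp (μ' * use)`, where `use`
  -- lies in `[0, 1]` and has conditional mean at most `R / n` times the remaining fraction. The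
  -- moment bound yields the relation between `μ` and `μ'`.
  set g : (K → ℝ) × ((Fin (T - t) → Item J K) × S) → ℝ := fun p =>
    Real.exp (-(R * μ' * ((b k - p.1 k) / b k))) * Real.exp (μ' * use p)
  have hg : Measurable g := by fun_prop
  have heq : ∀ ω : Scenario J K S T, Real.exp (-(R * μ' * remaining σ b k ω (t + 1))) =
      g (osoUsed σ b ω t, (stageItems ω t, ω.2.2 t)) := by
    intro ω
    simp only [g, use, remaining, osoUsed_succ, ← Real.exp_add, i₀, stageItems_zero]
    congr 1
    simp only [osoAction, stageAction, Pi.add_apply]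
    field_simp
    ring
  have hpos : 0 ≤ R * μ' := by positivity
  have hrem : ∀ᵐ ω ∂(scenarioLaw D ν T), ∀ s ≤ T, 0 ≤ remaining σ b k ω s := by
    filter_upwards [ae_nonneg_scenario (ν := ν) (T := T) hA] with ω hω s hs
    exact div_nonneg (sub_nonneg.2 ((osoUsed_mem σ hb hω s hs).2 k)) (hb k)
  have hint : Integrable (fun ω => g (osoUsed σ b ω t, (stageItems ω t, ω.2.2 t)))
      (scenarioLaw D ν T) := by
    simp only [← heq]
    refine Integrable.of_bound (Measurable.aestronglyMeasurable ?_) 1 ?_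
    · have := measurable_remaining (T := T) σ b k (t + 1)
      fun_prop
    · filter_upwards [hrem] with ω hω
      rw [Real.norm_of_nonneg (Real.exp_pos _).le]
      exact Real.exp_le_one_iff.2 (neg_nonpos.2 (mul_nonneg hpos (hω _ (by omega))))
  obtain ⟨hi, he⟩ := integral_stage σ b t hg hint
  simp only [heq]
  rw [he]
  have hle : ∀ᵐ ω ∂(scenarioLaw D ν T),
      ∫ y, g (osoUsed σ b ω t, y) ∂((Measure.pi fun _ => D).prod ν) ≤
        Real.exp (-(R * μ * remaining σ b k ω t)) := by
    filter_upwards [ae_nonneg_scenario (ν := ν) (T := T) hA] with ω hω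
    have hu := osoUsed_mem σ hb hω t (by omega)
    set u := osoUsed σ b ω t
    have hB : 0 ≤ b - u := sub_nonneg.2 hu.2
    have hc : 0 ≤ remaining σ b k ω t := div_nonneg (hB k) (hb k)
    have hmono : R * μ * remaining σ b k ω t ≤
        R * (μ' - (μ' + μ' ^ 2) / (T - t : ℕ)) * remaining σ b k ω t := by gcongr
    have hw : Measurable fun y => use (u, y) := by fun_prop
    have hmgf := integral_exp_mul_le (P := (Measure.pi fun _ : Fin (T - t) => D).prod ν)
      (w := fun y => use (u, y)) hw.aestronglyMeasurable (η := μ')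
      (m := R * (remaining σ b k ω t / (T - t : ℕ))) ?_ h0 h1 ?_
    · simp only [g]
      rw [integral_const_mul]
      calc _ ≤ Real.exp (-(R * μ' * ((b k - u k) / b k))) *
            Real.exp ((μ' + μ' ^ 2) * (R * (remaining σ b k ω t / (T - t : ℕ)))) := by gcongr
        _ ≤ _ := by
            rw [← Real.exp_add]
            refine Real.exp_le_exp.2 ?_
            have : (b k - u k) / b k = remaining σ b k ω t := rfl
            rw [this]
            have h2 : (μ' + μ' ^ 2) * (R * (remaining σ b k ω t / (T - t : ℕ))) =
              R * ((μ' + μ' ^ 2) / (T - t : ℕ)) * remaining σ b k ω t := by ring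
            rw [h2]
            linarith
    · filter_upwards [ae_prod_fst (ν := ν) (ae_pi_of_ae (ι := Fin (T - t)) hA),
        ae_prod_fst (ν := ν) (ae_pi_of_ae (ι := Fin (T - t)) hR)] with y hy hy'
      have hx := (σ.isOptimal_solve hB y.2 y.1).1.1 i₀
      have h3 := OnlineAllocation.itemUse_le hx (k := k) (c := b k / R) (by positivity)
        fun j => by rw [le_div_iff₀ hR0, mul_comm]; exact hy' i₀ j k
      refine ⟨mul_nonneg (by positivity) (itemUse_nonneg (hy i₀) hx k), ?_⟩
      calc use (u, y) ≤ R / b k * (b k / R) := mul_le_mul_of_nonneg_left h3 (by positivity)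
        _ = 1 := by field_simp
    · simp only [use]
      rw [integral_const_mul]
      calc _ ≤ R / b k * ((b - u) k / (T - t : ℕ)) :=
            mul_le_mul_of_nonneg_left (hσ.integral_itemUse_le hA hB i₀ k) (by positivity)
        _ = _ := by
            have : remaining σ b k ω t = (b k - u k) / b k := rfl
            rw [this, Pi.sub_apply]; ring
  have hgi : Integrable (fun ω => Real.exp (-(R * μ * remaining σ b k ω t)))
      (scenarioLaw D ν T) := by
    have hm := measurable_remaining (T := T) σ b k t
    refine Integrable.of_bound (Measurable.aestronglyMeasurable (by fun_prop))
      -- No sign is known for `μ` here, hence the absolute value.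
      (Real.exp (R * |μ|)) ?_
    filter_upwards [ae_nonneg_scenario (ν := ν) (T := T) hA] with ω hω
    have hu := osoUsed_mem σ hb hω t (by omega)
    have h2 : 0 ≤ remaining σ b k ω t := div_nonneg (sub_nonneg.2 (hu.2 k)) (hb k)
    have h3 : remaining σ b k ω t ≤ 1 :=
      div_le_one_of_le₀ (by have := hu.1 k; simp only [Pi.zero_apply] at this; linarith) (hb k)
    rw [Real.norm_of_nonneg (Real.exp_pos _).le]
    refine Real.exp_le_exp.2 ?_
    calc -(R * μ * remaining σ b k ω t) = R * (-μ * remaining σ b k ω t) := by ring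
      _ ≤ R * (|μ| * 1) := by
          gcongr
          exact neg_le_abs μ
      _ = _ := by ring
  exact integral_mono_ae hi hgi hle

/-- OSO keeps its resource usage proportional to time, with high probability. -/
theorem measure_remaining_lt_le {σ : Solver J K S} (hσ : σ.IsEquivariant ν) {b : K → ℝ}
    (hA : ∀ᵐ ξ ∂D, ∀ j k, 0 ≤ ξ.2 j k) (hb : 0 ≤ b) {R : ℝ} (hR0 : 0 < R)
    (hR : ∀ᵐ ξ ∂D, ∀ j k, R * ξ.2 j k ≤ b k) {k : K} (hk : 0 < b k) (t : Fin T) {μ : ℝ}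
    (h0 : 0 ≤ μ) (h1 : μ ≤ 1 / 2) :
    (scenarioLaw D ν T).real {ω | remaining σ b k ω t ≤ (1 - 4 * μ) * ((T - t : ℕ) / T)} ≤
      Real.exp (-(2 * R * ((T - t : ℕ) / T) * μ ^ 2)) := by
  set n : ℝ := ((T - t : ℕ) : ℝ)
  have hn : 1 ≤ n := by
    have : 1 ≤ T - (t : ℕ) := by omega
    simp only [n]; exact_mod_cast this
  have hnT : n ≤ T := by
    simp only [n]; exact_mod_cast Nat.sub_le T t
  have hT : (0 : ℝ) < T := by linarith
  -- The exponent to use when `m` periods are left. To first order the recursion in `hstep` keeps `m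
  -- * f m` constant, giving `μ * (n / m)`; the last factor is a correction paying for the quadratic
  -- term. At `m = n` the value is `μ`.
  set f : ℝ → ℝ := fun m => μ * (n / m) * (1 - 2 * μ * (1 - n / m))
  have hf01 : ∀ m, n ≤ m → 0 ≤ f m ∧ f m ≤ μ * (n / m) := by
    intro m hm
    have hm0 : 0 < m := by linarith
    have h2 : n / m ≤ 1 := (div_le_one hm0).2 hm
    have h3 : 0 ≤ n / m := by positivity
    have h4 : 0 ≤ μ * (n / m) := by positivity
    have h5 : 0 ≤ 2 * μ * (1 - n / m) := by
      have := sub_nonneg.2 h2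
      positivity
    have h6 : 2 * μ * (1 - n / m) ≤ 1 := by nlinarith
    exact ⟨mul_nonneg h4 (by linarith), mul_le_of_le_one_right h4 (by linarith)⟩
  have hstep : ∀ m, n ≤ m → f (m + 1) ≤ f m - (f m + f m ^ 2) / (m + 1) := by
    intro m hm
    have hm1 : 1 ≤ m := hn.trans hm
    obtain ⟨h2, h3⟩ := hf01 m hm
    have h4 : f m ^ 2 ≤ (μ * (n / m)) ^ 2 := by gcongr
    have h5 : (μ * (n / m)) ^ 2 ≤ m * f m - (m + 1) * f (m + 1) := by
      have : m * f m - (m + 1) * f (m + 1) = (μ * (n / m)) ^ 2 * (2 * m / (m + 1)) := by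
        simp only [f]
        field_simp
        ring
      rw [this]
      refine le_mul_of_one_le_right (by positivity) ?_
      rw [one_le_div (by positivity)]
      linarith
    have h6 : f m - (f m + f m ^ 2) / (m + 1) = (m * f m - f m ^ 2) / (m + 1) := by
      field_simp
      ring
    rw [h6, le_div_iff₀ (by positivity)]
    linarith
  have hchain : ∀ s : ℕ, s ≤ t →
      ∫ ω, Real.exp (-(R * f (T - s : ℕ) * remaining σ b k ω s)) ∂(scenarioLaw D ν T) ≤
        Real.exp (-(R * f T)) := by
    intro s
    induction s with
    | zero =>
      intro _
      have : ∀ ω : Scenario J K S T, remaining σ b k ω 0 = 1 := fun ω => by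
        simp [remaining, osoUsed, hk.ne']
      simp [this]
    | succ s ih =>
      intro hs
      refine le_trans ?_ (ih (by omega))
      have hm : n ≤ ((T - (s + 1) : ℕ) : ℝ) := by
        simp only [n]; exact_mod_cast Nat.sub_le_sub_left hs T
      have hcast : ((T - s : ℕ) : ℝ) = ((T - (s + 1) : ℕ) : ℝ) + 1 := by
        rw [show T - s = T - (s + 1) + 1 by omega]; push_cast; rfl
      obtain ⟨h2, h3⟩ := hf01 _ hm
      refine integral_exp_remaining_succ_le hσ hA hb hR0 hR hk ⟨s, by omega⟩ h2 ?_ ?_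
      · refine h3.trans ?_
        have : n / ((T - (s + 1) : ℕ) : ℝ) ≤ 1 := (div_le_one (by linarith)).2 hm
        nlinarith
      · simp only [hcast]
        exact hstep _ hm
  have hfin := hchain t le_rfl
  have hft : f (T - t : ℕ) = μ := by
    have : f (T - t : ℕ) = f n := rfl
    rw [this]
    have : n / n = 1 := div_self (by linarith)
    simp only [f, this]; ring
  rw [hft] at hfin
  -- In Markov's inequality this leaves `(1 - 2 μ) - (1 - 4 μ) = 2 μ`, the source of `2 R (n / T)
  -- μ²`.
  have hfT : μ * (n / T) * (1 - 2 * μ) ≤ f T := by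
    simp only [f]
    have h3 : 0 ≤ n / T := by positivity
    have h4 : 0 ≤ μ * (n / T) := by positivity
    refine mul_le_mul_of_nonneg_left ?_ h4
    nlinarith
  set L := Real.exp (-(R * μ * ((1 - 4 * μ) * (n / T))))
  have hmem : {ω : Scenario J K S T | remaining σ b k ω t ≤ (1 - 4 * μ) * (n / T)} ⊆
      {ω | L ≤ Real.exp (-(R * μ * remaining σ b k ω t))} := by
    intro ω hω
    refine Real.exp_le_exp.2 (neg_le_neg ?_)
    exact mul_le_mul_of_nonneg_left hω (by positivity)
  have hint : Integrable (fun ω => Real.exp (-(R * μ * remaining σ b k ω t)))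
      (scenarioLaw D ν T) := by
    have hm := measurable_remaining (T := T) σ b k t
    refine Integrable.of_bound (Measurable.aestronglyMeasurable (by fun_prop)) 1 ?_
    filter_upwards [ae_nonneg_scenario (ν := ν) (T := T) hA] with ω hω
    have hu := osoUsed_mem σ hb hω t (by omega)
    have h2 : 0 ≤ remaining σ b k ω t := div_nonneg (sub_nonneg.2 (hu.2 k)) (hb k)
    rw [Real.norm_of_nonneg (Real.exp_pos _).le]
    exact Real.exp_le_one_iff.2 (neg_nonpos.2 (by positivity))
  have hmarkov := mul_meas_ge_le_integral_of_nonneg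
    (.of_forall fun ω => (Real.exp_pos (-(R * μ * remaining σ b k ω t))).le) hint L
  have hL : 0 < L := Real.exp_pos _
  calc (scenarioLaw D ν T).real {ω | remaining σ b k ω t ≤ (1 - 4 * μ) * (n / T)} ≤
      (scenarioLaw D ν T).real {ω | L ≤ Real.exp (-(R * μ * remaining σ b k ω t))} :=
        measureReal_mono hmem
    _ ≤ Real.exp (-(R * f T)) / L := by
        rw [le_div_iff₀ hL, mul_comm]
        exact hmarkov.trans hfin
    _ ≤ _ := by
        rw [div_le_iff₀ hL, ← Real.exp_add]
        refine Real.exp_le_exp.2 ?_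
        have := mul_le_mul_of_nonneg_left hfT hR0.le
        nlinarith

end Concentration

/-! ### Reward per period and in total. -/

section Guarantee

variable {J K S : Type*} [Fintype J] [MeasurableSpace S] {T : ℕ}
  {D : Measure (Item J K)} [IsProbabilityMeasure D] {ν : Measure S} [IsProbabilityMeasure ν]

theorem integrable_osoReward_item (σ : Solver J K S) {s₀ : S} {b : K → ℝ}
    (hA : ∀ᵐ ξ ∂D, ∀ j k, 0 ≤ ξ.2 j k) (hb : 0 ≤ b)
    (hs : Integrable (σ.singleOpt s₀ b) D) (t : Fin T) :
    Integrable (fun ω => itemReward (ω.1 t) (osoAction σ b ω t)) (scenarioLaw D ν T) := by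
  have h1 : Integrable (fun ω : Scenario J K S T => σ.singleOpt s₀ b (ω.1 t))
      (scenarioLaw D ν T) :=
    (((measurePreserving_eval (fun _ : Fin T => D) t).comp
      measurePreserving_fst).integrable_comp
        (σ.measurable_singleOpt s₀ b).aestronglyMeasurable).2 hs
  have hU := measurable_osoUsed (T := T) σ b t
  refine h1.mono' (measurable_itemReward.comp (Measurable.prodMk (by fun_prop)
    (σ.measurable_comp (by fun_prop) (measurable_stageItems t) (measurable_const.sub hU)
      _))).aestronglyMeasurable ?_
  filter_upwards [ae_nonneg_scenario (ν := ν) (T := T) hA] with ω hω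
  have hu := osoUsed_mem σ hb hω t (by omega)
  obtain ⟨hx, hr, hk⟩ := itemUse_osoAction σ hω t hu.2
  refine (Real.norm_of_nonneg hr).trans_le (σ.itemReward_le_singleOpt s₀ hx fun k => ?_)
  have h2 := hu.1 k
  have h3 := (hk k).2
  simp only [Pi.zero_apply] at h2
  linarith

/-- Unless some resource has run low, which has probability at most `δ`, the stage instance is worth
its share up to `(1 - γ) (1 - δ)`; in the bad event the reward is still non-negative. -/
theorem Solver.IsEquivariant.le_integral_osoReward_item [Fintype K] {σ : Solver J K S}
    (hσ : σ.IsEquivariant ν) {s₀ : S} {b : K → ℝ} (hA : ∀ᵐ ξ ∂D, ∀ j k, 0 ≤ ξ.2 j k)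
    (hb : 0 ≤ b) (hs : Integrable (σ.singleOpt s₀ b) D)
    (hOPT : Integrable (fun ξ : Fin T → Item J K => offlineOpt b ξ)
      (Measure.pi fun _ : Fin T => D)) {R : ℝ} (hR0 : 0 < R)
    (hR : ∀ᵐ ξ ∂D, ∀ j k, R * ξ.2 j k ≤ b k) (t : Fin T) {γ : ℝ} (hγ0 : 0 ≤ γ)
    {Λ δ : ℝ} (hΛ : 1 ≤ Λ) (hγΛ : 128 * Λ ≤ (T - t : ℕ) * R / T * γ ^ 2)
    (hδ : Fintype.card K * Real.exp (-Λ) ≤ δ) (hδ1 : δ ≤ 1) :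
    (1 - γ - 2 * δ) *
        ((∫ ξ : Fin T → Item J K, offlineOpt b ξ ∂(Measure.pi fun _ => D)) / T) ≤
      ∫ ω, itemReward (ω.1 t) (osoAction σ b ω t) ∂(scenarioLaw D ν T) := by
  set V := (∫ ξ : Fin T → Item J K, offlineOpt b ξ ∂(Measure.pi fun _ => D)) / (T : ℝ)
  have hT : 0 < T := t.pos
  have hV : 0 ≤ V := by
    refine div_nonneg (integral_nonneg fun ξ => ?_) (by positivity)
    exact (σ.singleOpt_nonneg s₀ hb _).trans (σ.singleOpt_le_offlineOpt s₀ hb ξ t)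
  have hδ0 : 0 ≤ δ := le_trans (by positivity) hδ
  -- Near the end of the horizon `γ` may exceed 1; the bound is then non-positive and holds
  -- trivially.
  rcases lt_or_ge 1 γ with hγ1 | hγ1
  · refine le_trans (mul_nonpos_of_nonpos_of_nonneg (by linarith) hV) ?_
    refine integral_nonneg_of_ae ?_
    filter_upwards [ae_nonneg_scenario (ν := ν) (T := T) hA] with ω hω
    exact (itemUse_osoAction σ hω t (osoUsed_mem σ hb hω t (by omega)).2).2.1
  set i₀ : Fin (T - t) := ⟨0, by omega⟩
  set g : (K → ℝ) × ((Fin (T - t) → Item J K) × S) → ℝ := fun p =>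
    itemReward (p.2.1 i₀) (σ.solve p.2.2 (T - t) p.2.1 (b - p.1) i₀)
  have hg : Measurable g := measurable_itemReward.comp (Measurable.prodMk (by fun_prop)
    (σ.measurable_comp (by fun_prop) (by fun_prop) (by fun_prop) i₀))
  have heq : ∀ ω : Scenario J K S T, itemReward (ω.1 t) (osoAction σ b ω t) =
      g (osoUsed σ b ω t, (stageItems ω t, ω.2.2 t)) := fun ω => by
    simp only [g, i₀, stageItems_zero]; rfl
  have hint := integrable_osoReward_item (T := T) (ν := ν) σ hA hb hs t
  simp only [heq] at hint ⊢
  obtain ⟨hi, he⟩ := integral_stage σ b t hg hint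
  rw [he]
  -- Taking `μ = γ / 16` makes `4 μ` the slack `γ / 4` required of the capacities, and turns the
  -- tail exponent into `(n R / T) γ² / 128`. Zero capacities are left out: for them the required
  -- lower bound is 0.
  set bad : Set (Scenario J K S T) :=
    {ω | ∃ k, 0 < b k ∧ remaining σ b k ω t ≤ (1 - 4 * (γ / 16)) * ((T - t : ℕ) / T)}
  have hbad : MeasurableSet bad := by
    have : bad = ⋃ k, {ω | 0 < b k ∧
        remaining σ b k ω t ≤ (1 - 4 * (γ / 16)) * ((T - t : ℕ) / T)} := by
      ext ω; simp [bad]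
    rw [this]
    refine MeasurableSet.iUnion fun k => ?_
    by_cases hk : 0 < b k
    · simpa [hk] using measurableSet_le (measurable_remaining σ b k t) measurable_const
    · simp [hk]
  have hbadm : (scenarioLaw D ν T).real bad ≤ δ := by
    refine le_trans ?_ hδ
    have h1 : bad ⊆ ⋃ k ∈ (Finset.univ : Finset K), {ω | 0 < b k ∧
        remaining σ b k ω t ≤ (1 - 4 * (γ / 16)) * ((T - t : ℕ) / T)} := by
      intro ω hω
      simpa [bad] using hω
    refine (measureReal_mono h1 (measure_ne_top _ _)).trans ((measureReal_biUnion_finset_le _ _).trans ?_)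
    calc _ ≤ ∑ _k : K, Real.exp (-Λ) := by
          refine Finset.sum_le_sum fun k _ => ?_
          by_cases hk : 0 < b k
          · simp only [hk, true_and]
            refine (measure_remaining_lt_le hσ hA hb hR0 hR hk t (μ := γ / 16) (by positivity)
              (by linarith)).trans (Real.exp_le_exp.2 ?_)
            have : 2 * R * ((T - t : ℕ) / T) * (γ / 16) ^ 2 =
              ((T - t : ℕ) * R / T * γ ^ 2) / 128 := by ring
            rw [this]
            linarith
          · simp only [hk, false_and, Set.ofPred_false, measureReal_empty]
            exact (Real.exp_pos _).le
      _ = _ := by simp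
  set m := (1 - γ) * (1 - δ) * V
  have hm : 0 ≤ m := mul_nonneg (mul_nonneg (by linarith) (by linarith)) hV
  have hlow : ∀ᵐ ω ∂(scenarioLaw D ν T), badᶜ.indicator (fun _ => m) ω ≤
      ∫ y, g (osoUsed σ b ω t, y) ∂((Measure.pi fun _ => D).prod ν) := by
    filter_upwards [ae_nonneg_scenario (ν := ν) (T := T) hA] with ω hω
    have hu := osoUsed_mem σ hb hω t (by omega)
    have hB : 0 ≤ b - osoUsed σ b ω t := sub_nonneg.2 hu.2
    by_cases hω' : ω ∈ bad
    · simp only [Set.indicator, Set.mem_compl_iff, hω', not_true_eq_false, if_false]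
      refine integral_nonneg_of_ae ?_
      filter_upwards [ae_prod_fst (ν := ν) (ae_pi_of_ae (ι := Fin (T - t)) hA)] with y hy
      exact (σ.isOptimal_solve hB y.2 y.1).itemReward_nonneg hy i₀
    · simp only [Set.indicator, Set.mem_compl_iff, hω', not_false_eq_true, if_true]
      refine hσ.le_integral_itemReward hA hb hT hs hOPT hR0.le hR hγ0 hγ1 i₀ hB
        (sub_le_self b hu.1) (fun k => ?_) hΛ (by linarith) hδ
      rcases (hb k).eq_or_lt with h | h
      · rw [← h]; simpa using hB k
      · have h2 : ¬ (remaining σ b k ω t ≤ (1 - 4 * (γ / 16)) * ((T - t : ℕ) / T)) :=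
          fun h' => hω' ⟨k, h, h'⟩
        have h3 := (not_le.1 h2).le
        rw [remaining, le_div_iff₀ h] at h3
        have h4 : 1 - 4 * (γ / 16) = 1 - γ / 4 := by ring
        rwa [h4] at h3
  calc (1 - γ - 2 * δ) * V ≤ (1 - δ) * m := by
        simp only [m]
        have h5 : 1 - γ - 2 * δ ≤ (1 - δ) * ((1 - γ) * (1 - δ)) := by
          nlinarith [mul_nonneg hγ0 hδ0, mul_nonneg (mul_nonneg hγ0 hδ0) (sub_nonneg.2 hδ1),
            sq_nonneg δ]
        calc _ ≤ (1 - δ) * ((1 - γ) * (1 - δ)) * V := mul_le_mul_of_nonneg_right h5 hV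
          _ = _ := by ring
    _ ≤ (scenarioLaw D ν T).real badᶜ * m := by
        rw [probReal_compl_eq_one_sub hbad]
        gcongr
    _ = ∫ ω, badᶜ.indicator (fun _ => m) ω ∂(scenarioLaw D ν T) := by
        rw [integral_indicator_const _ hbad.compl, smul_eq_mul]
    _ ≤ _ := integral_mono_ae ((integrable_const m).indicator hbad.compl) hi hlow

/-- The guarantee in terms of the ratio `R` of capacities to consumptions. -/
theorem Solver.IsEquivariant.osoReward_guarantee [Fintype K] {σ : Solver J K S}
    (hσ : σ.IsEquivariant ν) {b : K → ℝ} (hA : ∀ᵐ ξ ∂D, ∀ j k, 0 ≤ ξ.2 j k)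
    (hb : 0 ≤ b) (hT : 0 < T)
    (hOPT : Integrable (fun ξ : Fin T → Item J K => offlineOpt b ξ)
      (Measure.pi fun _ : Fin T => D)) {ε R Λ : ℝ} (hε : 0 < ε) (hε1 : ε ≤ 1)
    (hR : ∀ᵐ ξ ∂D, ∀ j k, R * ξ.2 j k ≤ b k) (hΛ : 1 ≤ Λ) (hRΛ : 8192 * Λ ≤ R * ε ^ 2)
    (hδ : Fintype.card K * Real.exp (-Λ) ≤ ε / 4) :
    Integrable (fun ω => osoReward σ b ω) (scenarioLaw D ν T) ∧
      (1 - ε) * ∫ ξ : Fin T → Item J K, offlineOpt b ξ ∂(Measure.pi fun _ => D) ≤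
        ∫ ω, osoReward σ b ω ∂(scenarioLaw D ν T) := by
  obtain ⟨s₀⟩ : Nonempty S := ν.nonempty_of_neZero
  have hs := σ.integrable_singleOpt s₀ hb hT hOPT
  have hi := integrable_osoReward_item (T := T) (ν := ν) σ hA hb hs
  refine ⟨integrable_finsetSum Finset.univ fun t _ => hi t, ?_⟩
  have hT0 : (0 : ℝ) < T := by exact_mod_cast hT
  have hR0 : 0 < R := by
    by_contra! h
    have := mul_nonpos_of_nonpos_of_nonneg h (sq_nonneg ε)
    linarith
  set V := ∫ ξ : Fin T → Item J K, offlineOpt b ξ ∂(Measure.pi fun _ => D)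
  have hV : 0 ≤ V := integral_nonneg fun ξ =>
    (σ.singleOpt_nonneg s₀ hb _).trans (σ.singleOpt_le_offlineOpt s₀ hb ξ ⟨0, hT⟩)
  -- With `γ = (ε / 8) √(T / n)`, the quantity `(n R / T) γ²` equals `R ε² / 64` in every period,
  -- and `128 * 64 = 8192`. Summed over the periods, the relative loss is at most `ε / 4 + ε / 2`.
  have hstage : ∀ t : Fin T, (1 - ε / 8 * √((T : ℝ) / (T - t : ℕ)) - 2 * (ε / 4)) * (V / T) ≤
      ∫ ω, itemReward (ω.1 t) (osoAction σ b ω t) ∂(scenarioLaw D ν T) := fun t => by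
    have hn : (0 : ℝ) < (T - t : ℕ) := by
      have : 0 < T - (t : ℕ) := by omega
      exact_mod_cast this
    refine hσ.le_integral_osoReward_item hA hb hs hOPT hR0 hR t (by positivity) hΛ ?_ hδ
      (by linarith)
    rw [mul_pow, Real.sq_sqrt (by positivity)]
    have : ((T - t : ℕ) : ℝ) * R / T * ((ε / 8) ^ 2 * (T / (T - t : ℕ))) = R * ε ^ 2 / 64 := by
      field_simp
      ring
    rw [this]
    linarith
  have heq : ∫ ω, osoReward σ b ω ∂(scenarioLaw D ν T) =
      ∑ t, ∫ ω, itemReward (ω.1 t) (osoAction σ b ω t) ∂(scenarioLaw D ν T) :=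
    integral_finsetSum Finset.univ fun t _ => hi t
  rw [heq]
  refine le_trans ?_ (Finset.sum_le_sum fun t _ => hstage t)
  rw [← Finset.sum_mul, Finset.sum_sub_distrib, Finset.sum_sub_distrib, ← Finset.mul_sum]
  simp only [Finset.sum_const, Finset.card_univ, Fintype.card_fin, nsmul_eq_mul, mul_one]
  have h1 := sum_sqrt_div_le T
  have h2 : (1 - ε) * V = ((1 - ε) * T) * (V / T) := by field_simp
  rw [h2]
  refine mul_le_mul_of_nonneg_right ?_ (by positivity)
  nlinarith [mul_le_mul_of_nonneg_left h1 hε.le]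

end Guarantee

end OnlineAllocation

/-! ### The theorem: degenerate cases and the choice of constants. -/

theorem theorem1 {J K S : Type*} [Fintype J] [Fintype K] [MeasurableSpace S]
    (T : ℕ) (b : K → ℝ)
    (D : Measure (OnlineAllocation.Item J K)) [IsProbabilityMeasure D]
    (ν : Measure S) [IsProbabilityMeasure ν]
    (σ : OnlineAllocation.Solver J K S) (hσ : σ.IsEquivariant ν)
    (ε : ℝ) (hε : 0 < ε) (hε' : ε ≤ 0.001)
    (hA : ∀ᵐ ξ ∂D, ∀ j k, 0 ≤ ξ.2 j k)
    (hb : ∀ᵐ ξ ∂D, ∀ j k,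
      1024 * Real.log (2 * (Fintype.card K : ℝ) * (T : ℝ) / ε) *
        (Real.log (1 / ε) ^ 3 / ε ^ 2) * ξ.2 j k ≤ b k)
    (hOPT : Integrable (fun ξ : Fin T → OnlineAllocation.Item J K =>
      OnlineAllocation.offlineOpt b ξ) (Measure.pi fun _ : Fin T => D)) :
    Integrable (fun ω : OnlineAllocation.Scenario J K S T =>
        OnlineAllocation.osoReward σ b ω) (OnlineAllocation.scenarioLaw D ν T) ∧
      (1 - ε) * ∫ ξ : Fin T → OnlineAllocation.Item J K,
          OnlineAllocation.offlineOpt b ξ ∂(Measure.pi fun _ : Fin T => D) ≤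
        ∫ ω : OnlineAllocation.Scenario J K S T,
          OnlineAllocation.osoReward σ b ω ∂(OnlineAllocation.scenarioLaw D ν T) := by
  -- All rewards vanish here. With no supply nodes the capacity hypothesis is void and `b` may be
  -- negative, so the main argument would not apply.
  by_cases htriv : T = 0 ∨ IsEmpty J
  · have hR : ∀ {n : ℕ} (ξ : Fin n → OnlineAllocation.Item J K) (x : Fin n → J → ℝ),
        n = T → OnlineAllocation.totalReward ξ x = 0 := by
      rintro n ξ x rfl
      rcases htriv with rfl | h
      · simp [OnlineAllocation.totalReward]
      · simp [OnlineAllocation.totalReward, OnlineAllocation.itemReward]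
    have h1 : ∀ ω : OnlineAllocation.Scenario J K S T,
        OnlineAllocation.osoReward σ b ω = 0 := fun ω => hR _ _ rfl
    have h2 : ∀ ξ : Fin T → OnlineAllocation.Item J K,
        OnlineAllocation.offlineOpt b ξ ≤ 0 := fun ξ =>
      Real.sSup_nonpos (by rintro _ ⟨x, -, rfl⟩; exact (hR _ _ rfl).le)
    simp only [h1]
    refine ⟨integrable_zero _ _ _, ?_⟩
    rw [integral_zero]
    exact mul_nonpos_of_nonneg_of_nonpos (by linarith) (integral_nonpos h2)
  push Not at htriv
  obtain ⟨hT, hJ⟩ := htriv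
  have hT1 : (1 : ℝ) ≤ T := by exact_mod_cast Nat.one_le_iff_ne_zero.2 hT
  have hT' : 0 < T := Nat.pos_of_ne_zero hT
  rcases isEmpty_or_nonempty K with hK | hK
  -- Without resources the logarithm in the hypothesis is `Real.log 0 = 0`, but every ratio `R` is
  -- admissible, so a convenient one is chosen.
  · exact hσ.osoReward_guarantee hA (fun k => hK.elim k) hT' hOPT (R := 8192 / ε ^ 2) (Λ := 1)
      hε (by linarith) (.of_forall fun _ _ k => hK.elim k) le_rfl
      (by field_simp; norm_num) (by simp; positivity)
  have hd : (1 : ℝ) ≤ Fintype.card K := by exact_mod_cast Fintype.card_pos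
  set x : ℝ := 2 * (Fintype.card K : ℝ) * (T : ℝ) / ε
  have hdT : (1 : ℝ) ≤ Fintype.card K * T := one_le_mul_of_one_le_of_one_le hd hT1
  have hinv : 1000 ≤ 1 / ε := by
    rw [le_div_iff₀ hε]
    linarith
  have hx : 1000 ≤ x := by
    have : x = 2 * (Fintype.card K * T) * (1 / ε) := by simp only [x]; ring
    rw [this]
    nlinarith
  have hlog_ge : ∀ y : ℝ, 1000 ≤ y → 4 ≤ Real.log y := by
    intro y hy
    rw [Real.le_log_iff_exp_le (by linarith)]
    have h1 : Real.exp 4 = Real.exp 1 ^ 4 := by rw [← Real.exp_nat_mul]; norm_num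
    have h2 : Real.exp 1 ^ 4 ≤ 3 ^ 4 := by
      have := Real.exp_one_lt_d9
      gcongr
      linarith
    rw [h1]
    linarith
  have hlog := hlog_ge x hx
  have hlog2 := hlog_ge _ hinv
  set R := 1024 * Real.log x * (Real.log (1 / ε) ^ 3 / ε ^ 2)
  have hR0 : 0 ≤ R := by positivity
  have hb0 : 0 ≤ b := by
    obtain ⟨ξ, h1, h2⟩ := (hA.and hb).exists
    obtain ⟨j⟩ := hJ
    exact fun k => (mul_nonneg hR0 (h1 j k)).trans (h2 j k)
  -- With this `Λ`, `exp (-Λ) = 1 / x²`, and `d / x ≤ ε / 2` together with `1 / x ≤ 1 / 2` gives `δ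
  -- = ε / 4`. The requirement `16384 log x ≤ R ε²` needs only `log³ (1 / ε) ≥ 16`, and `log (1 / ε)
  -- ≥ 4`.
  refine hσ.osoReward_guarantee hA hb0 hT' hOPT (Λ := 2 * Real.log x)
    hε (by linarith) hb (by linarith) ?_ ?_
  · have : R * ε ^ 2 = 1024 * Real.log x * Real.log (1 / ε) ^ 3 := by
      simp only [R]; field_simp
    rw [this]
    have : (4 : ℝ) ^ 3 ≤ Real.log (1 / ε) ^ 3 := by gcongr
    nlinarith
  · have hx0 : 0 < x := by linarith
    have : Real.exp (-(2 * Real.log x)) = 1 / x * (1 / x) := by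
      rw [two_mul, neg_add, Real.exp_add, Real.exp_neg, Real.exp_log hx0, one_div]
    rw [this]
    have h1 : Fintype.card K * (1 / x) ≤ ε / 2 := by
      have hne : (Fintype.card K : ℝ) ≠ 0 := by linarith
      have : Fintype.card K * (1 / x) = ε / 2 / T := by
        simp only [x]; field_simp
      rw [this]
      exact div_le_self (by positivity) hT1
    have h2 : 1 / x ≤ 1 / 2 := one_div_le_one_div_of_le two_pos (by linarith)
    rw [← mul_assoc]
    calc _ ≤ ε / 2 * (1 / 2) := mul_le_mul h1 h2 (by positivity) (by positivity)
      _ = ε / 4 := by ring
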